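/- **(Inf–sup identity for the heat operator.)** Let $d\ge 1$, let $\Omega\subset\mathbb{R}^d$ be a nonempty bounded open set, and let $T>0$. Let $(\cdot,\cdot)_\Omega$ and $\|\cdot\|_\Omega$ be the inner product and norm of $L^2(\Omega)$ and of $L^2(\Omega;\mathbb{R}^d)$. Let $H^1_0(\Omega)$ be the closure of $C_0^\infty(\Omega)$ in $H^1(\Omega)$, and let $H^{-1}(\Omega)$ be its dual space, with duality pairing $\langle\cdot,\cdot\rangle$ and norm $$\|\Phi\|_{H^{-1}(\Omega)}=\sup_{v\in H^1_0(\Omega)\setminus\{0\}}\frac{\langle\Phi,v\rangle}{\|\nabla v\|_\Omega}.$$ The space $L^2(\Omega)$ is embedded in $H^{-1}(\Omega)$ by $\langle w,v\rangle=(w,v)_\Omega$. Let $X=L^2(0,T;H^1_0(\Omega))$ with norm $\|v\|_X^2=\int_0^T\|\nabla v\|_\Omega^2\,\mathrm{d}t$, and let $Y=L^2(0,T;H^1_0(\Omega))\cap H^1(0,T;H^{-1}(\Omega))$, that is, the set of $\varphi\in X$ which, as $H^{-1}(\Omega)$-valued functions, have a weak time derivative $\partial_t\varphi\in L^2(0,T;H^{-1}(\Omega))$.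 Then every $\varphi\in Y$ has a representative in $C([0,T];L^2(\Omega))$, which defines $\varphi(0),\varphi(T)\in L^2(\Omega)$. With $$\|\varphi\|_Y^2=\int_0^T\left(\|\partial_t\varphi\|_{H^{-1}(\Omega)}^2+\|\nabla\varphi\|_\Omega^2\right)\mathrm{d}t+\|\varphi(T)\|_\Omega^2,\qquad B_Y(\varphi,v)=\int_0^T\left(\langle\partial_t\varphi,v\rangle+(\nabla\varphi,\nabla v)_\Omega\right)\mathrm{d}t\quad(v\in X),$$ the supremum below is that of a nonempty set of real numbers, is finite, and satisfies $$\|\varphi\|_Y^2=\left[\sup_{v\in X\setminus\{0\}}\frac{B_Y(\varphi,v)}{\|v\|_X}\right]^2+\|\varphi(0)\|_\Omega^2 .$$ -/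

import Mathlib

open MeasureTheory Set Filter
open scoped ContDiff

noncomputable section

/-- `ψ ∈ C₀^∞(U)`: smooth, with compact support contained in `U`. -/
def IsTestFunction {E : Type*} [NormedAddCommGroup E] [NormedSpace ℝ E]
    (U : Set E) (ψ : E → ℝ) : Prop :=
  ContDiff ℝ ∞ ψ ∧ HasCompactSupport ψ ∧ tsupport ψ ⊆ U

section Space

variable {d : ℕ}

/-- `L²(Ω)`. -/
abbrev L2 (Ω : Set (EuclideanSpace ℝ (Fin d))) : Type :=
  Lp ℝ 2 (volume.restrict Ω)

/-- `L²(Ω; ℝᵈ)`. -/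
abbrev L2Vec (Ω : Set (EuclideanSpace ℝ (Fin d))) : Type :=
  Lp (EuclideanSpace ℝ (Fin d)) 2 (volume.restrict Ω)

/-- `g` is the weak gradient of `u` on `Ω`: `∫ u ∂ᵢψ = - ∫ gᵢ ψ` for all `i`, `ψ ∈ C₀^∞(Ω)`. -/
def IsWeakGradient (Ω : Set (EuclideanSpace ℝ (Fin d))) (u : L2 Ω) (g : L2Vec Ω) : Prop :=
  ∀ (i : Fin d) (ψ : EuclideanSpace ℝ (Fin d) → ℝ), IsTestFunction Ω ψ →
    ∫ x in Ω, u x * fderiv ℝ ψ x (EuclideanSpace.single i 1) = - ∫ x in Ω, g x i * ψ x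

theorem IsTestFunction.integrable_mul {Ω : Set (EuclideanSpace ℝ (Fin d))}
    {ψ : EuclideanSpace ℝ (Fin d) → ℝ} (hψ : IsTestFunction Ω ψ)
    {f : EuclideanSpace ℝ (Fin d) → ℝ} (hf : MemLp f 2 (volume.restrict Ω)) :
    Integrable (fun x => f x * ψ x) (volume.restrict Ω) :=
  hf.integrable_mul (q := 2) (hψ.1.continuous.memLp_of_hasCompactSupport hψ.2.1)

theorem IsTestFunction.fderiv_apply {Ω : Set (EuclideanSpace ℝ (Fin d))}
    {ψ : EuclideanSpace ℝ (Fin d) → ℝ} (hψ : IsTestFunction Ω ψ)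
    (e : EuclideanSpace ℝ (Fin d)) : IsTestFunction Ω (fun x => fderiv ℝ ψ x e) := by
  refine ⟨(hψ.1.fderiv_right (m := ∞) (by simp)).clm_apply contDiff_const,
    hψ.2.1.fderiv_apply ℝ e, ?_⟩
  exact (tsupport_fderiv_apply_subset ℝ e).trans hψ.2.2

theorem memLp_coord {Ω : Set (EuclideanSpace ℝ (Fin d))} (g : L2Vec Ω) (i : Fin d) :
    MemLp (fun x => g x i) 2 (volume.restrict Ω) :=
  (EuclideanSpace.proj (𝕜 := ℝ) i).comp_memLp' (Lp.memLp g)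

/-- `H¹(Ω)`, realised as the pairs `(u, ∇u)` with `u ∈ L²(Ω)` and weak gradient
`∇u ∈ L²(Ω; ℝᵈ)`, so that the norm is `(‖u‖² + ‖∇u‖²)^(1/2)`. -/
def H1Submodule (Ω : Set (EuclideanSpace ℝ (Fin d))) :
    Submodule ℝ (WithLp 2 (L2 Ω × L2Vec Ω)) where
  carrier := {w | IsWeakGradient Ω w.fst w.snd}
  zero_mem' := by
    intro i ψ hψ
    have h1 : ∀ᵐ x ∂(volume.restrict Ω),
        (0 : WithLp 2 (L2 Ω × L2Vec Ω)).fst x = 0 := Lp.coeFn_zero _ _ _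
    have h2 : ∀ᵐ x ∂(volume.restrict Ω),
        (0 : WithLp 2 (L2 Ω × L2Vec Ω)).snd x = 0 := Lp.coeFn_zero _ _ _
    rw [integral_eq_zero_of_ae, integral_eq_zero_of_ae, neg_zero]
    · filter_upwards [h2] with x hx
      rw [hx]
      simp
    · filter_upwards [h1] with x hx
      rw [hx]
      simp
  add_mem' := by
    intro a b ha hb i ψ hψ
    have e1 : ∀ᵐ x ∂(volume.restrict Ω), (a + b).fst x = a.fst x + b.fst x :=
      Lp.coeFn_add a.fst b.fst
    have e2 : ∀ᵐ x ∂(volume.restrict Ω), (a + b).snd x = a.snd x + b.snd x :=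
      Lp.coeFn_add a.snd b.snd
    have hd := hψ.fderiv_apply (EuclideanSpace.single i (1 : ℝ))
    calc ∫ x in Ω, (a + b).fst x * fderiv ℝ ψ x (EuclideanSpace.single i 1)
        = ∫ x in Ω, (a.fst x * fderiv ℝ ψ x (EuclideanSpace.single i 1)
            + b.fst x * fderiv ℝ ψ x (EuclideanSpace.single i 1)) := by
          refine integral_congr_ae ?_
          filter_upwards [e1] with x hx
          rw [hx, add_mul]
      _ = - ∫ x in Ω, (a.snd x i * ψ x + b.snd x i * ψ x) := by
          rw [integral_add (hd.integrable_mul (Lp.memLp a.fst))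
            (hd.integrable_mul (Lp.memLp b.fst)),
            integral_add (hψ.integrable_mul (memLp_coord a.snd i))
            (hψ.integrable_mul (memLp_coord b.snd i)), ha i ψ hψ, hb i ψ hψ, neg_add]
      _ = - ∫ x in Ω, (a + b).snd x i * ψ x := by
          congr 1
          refine integral_congr_ae ?_
          filter_upwards [e2] with x hx
          rw [hx, PiLp.add_apply, add_mul]
  smul_mem' := by
    intro c a ha i ψ hψ
    have e1 : ∀ᵐ x ∂(volume.restrict Ω), (c • a).fst x = c * a.fst x :=
      Lp.coeFn_smul c a.fst
    have e2 : ∀ᵐ x ∂(volume.restrict Ω), (c • a).snd x = c • a.snd x :=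
      Lp.coeFn_smul c a.snd
    calc ∫ x in Ω, (c • a).fst x * fderiv ℝ ψ x (EuclideanSpace.single i 1)
        = ∫ x in Ω, c * (a.fst x * fderiv ℝ ψ x (EuclideanSpace.single i 1)) := by
          refine integral_congr_ae ?_
          filter_upwards [e1] with x hx
          rw [hx, mul_assoc]
      _ = - ∫ x in Ω, c * (a.snd x i * ψ x) := by
          rw [integral_const_mul, integral_const_mul, ha i ψ hψ, mul_neg]
      _ = - ∫ x in Ω, (c • a).snd x i * ψ x := by
          congr 1
          refine integral_congr_ae ?_
          filter_upwards [e2] with x hx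
          rw [hx, PiLp.smul_apply, smul_eq_mul, mul_assoc]

/-- The space `H¹(Ω)`. -/
def H1 (Ω : Set (EuclideanSpace ℝ (Fin d))) : Type := H1Submodule Ω

instance (Ω : Set (EuclideanSpace ℝ (Fin d))) : NormedAddCommGroup (H1 Ω) :=
  inferInstanceAs (NormedAddCommGroup (H1Submodule Ω))

instance (Ω : Set (EuclideanSpace ℝ (Fin d))) : InnerProductSpace ℝ (H1 Ω) :=
  inferInstanceAs (InnerProductSpace ℝ (H1Submodule Ω))

/-- The inclusion `u ↦ (u, ∇u)` of `H¹(Ω)` in `L²(Ω) × L²(Ω; ℝᵈ)`. -/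
def H1.incl (Ω : Set (EuclideanSpace ℝ (Fin d))) : H1 Ω →L[ℝ] WithLp 2 (L2 Ω × L2Vec Ω) :=
  (H1Submodule Ω).subtypeL

/-- `H¹₀(Ω)`: the closure of `C₀^∞(Ω)` in `H¹(Ω)`.  (The spanning set is already a subspace.) -/
def H10Submodule (Ω : Set (EuclideanSpace ℝ (Fin d))) : Submodule ℝ (H1 Ω) :=
  (Submodule.span ℝ {w : H1 Ω | ∃ ψ, IsTestFunction Ω ψ ∧
    ∀ᵐ x ∂(volume.restrict Ω), (H1.incl Ω w).fst x = ψ x}).topologicalClosure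

/-- The space `H¹₀(Ω)`, as a normed space with the `H¹(Ω)` norm. -/
def H10 (Ω : Set (EuclideanSpace ℝ (Fin d))) : Type := H10Submodule Ω

instance (Ω : Set (EuclideanSpace ℝ (Fin d))) : NormedAddCommGroup (H10 Ω) :=
  inferInstanceAs (NormedAddCommGroup (H10Submodule Ω))

instance (Ω : Set (EuclideanSpace ℝ (Fin d))) : InnerProductSpace ℝ (H10 Ω) :=
  inferInstanceAs (InnerProductSpace ℝ (H10Submodule Ω))

/-- The inclusion of `H¹₀(Ω)` in `H¹(Ω)`. -/
def H10.incl (Ω : Set (EuclideanSpace ℝ (Fin d))) : H10 Ω →L[ℝ] H1 Ω :=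
  (H10Submodule Ω).subtypeL

/-- The embedding `H¹₀(Ω) → L²(Ω)`. -/
def toL2 (Ω : Set (EuclideanSpace ℝ (Fin d))) : H10 Ω →L[ℝ] L2 Ω :=
  (WithLp.fstL 2 ℝ (L2 Ω) (L2Vec Ω)).comp ((H1.incl Ω).comp (H10.incl Ω))

/-- The gradient `∇ : H¹₀(Ω) → L²(Ω; ℝᵈ)`. -/
def grad (Ω : Set (EuclideanSpace ℝ (Fin d))) : H10 Ω →L[ℝ] L2Vec Ω :=
  (WithLp.sndL 2 ℝ (L2 Ω) (L2Vec Ω)).comp ((H1.incl Ω).comp (H10.incl Ω))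

/-- `H⁻¹(Ω)`: the dual space of `H¹₀(Ω)`; the pairing `⟨Φ, v⟩` is `Φ v`. -/
abbrev HNeg (Ω : Set (EuclideanSpace ℝ (Fin d))) : Type :=
  StrongDual ℝ (H10 Ω)

/-- The norm of `H⁻¹(Ω)`: the supremum of `⟨Φ, v⟩ / ‖∇v‖` over `v ∈ H¹₀(Ω) \ {0}`.
It is equivalent to the norm of `HNeg Ω` as the dual of `H¹₀(Ω)` with the `H¹` norm, so both
give the same measurable functions and the same Bochner spaces. -/
def normHNeg (Ω : Set (EuclideanSpace ℝ (Fin d))) (Φ : HNeg Ω) : ℝ :=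
  sSup {r | ∃ v : H10 Ω, v ≠ 0 ∧ r = Φ v / ‖grad Ω v‖}

/-- The canonical embedding `L²(Ω) → H⁻¹(Ω)`, `⟨w, v⟩ = (w, v)_Ω`. -/
def L2toHNeg (Ω : Set (EuclideanSpace ℝ (Fin d))) (w : L2 Ω) : HNeg Ω :=
  (innerSL ℝ w).comp (toL2 Ω)

end Space

section Bochner

variable {V : Type*} [NormedAddCommGroup V] [NormedSpace ℝ V]

/-- `w` is the weak time derivative of `u` on the interval `I`:
`∫ ∂ₜθ u = - ∫ θ w` (Bochner integrals) for all `θ ∈ C₀^∞(I)`. -/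
def IsWeakTimeDeriv (I : Set ℝ) (u w : ℝ → V) : Prop :=
  ∀ θ : ℝ → ℝ, IsTestFunction I θ → ∫ t in I, deriv θ t • u t = - ∫ t in I, θ t • w t

/-- `u ∈ H¹(I; V)`: `u ∈ L²(I; V)` has a weak time derivative in `L²(I; V)`. -/
def MemH1Time (I : Set ℝ) (u : ℝ → V) : Prop :=
  MemLp u 2 (volume.restrict I) ∧
    ∃ w : ℝ → V, MemLp w 2 (volume.restrict I) ∧ IsWeakTimeDeriv I u w

open Classical in
/-- The weak time derivative of `u ∈ H¹(I; V)` (determined almost everywhere on `I`). -/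
def weakTimeDeriv (I : Set ℝ) (u : ℝ → V) : ℝ → V :=
  if h : MemH1Time I u then h.2.choose else 0

end Bochner

section Parabolic

variable {d : ℕ}

/-- `X = L²(0,T; H¹₀(Ω))`. -/
abbrev SpaceX (Ω : Set (EuclideanSpace ℝ (Fin d))) (T : ℝ) : Type :=
  Lp (H10 Ω) 2 (volume.restrict (Ioo 0 T))

/-- `‖v‖_X = (∫₀ᵀ ‖∇v‖² dt)^(1/2)`. -/
def normX (Ω : Set (EuclideanSpace ℝ (Fin d))) (T : ℝ) (v : SpaceX Ω T) : ℝ :=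
  Real.sqrt (∫ t in Ioo 0 T, ‖grad Ω (v t)‖ ^ 2)

/-- A function in `X`, regarded as a function with values in `H⁻¹(Ω)`. -/
def asHNeg (Ω : Set (EuclideanSpace ℝ (Fin d))) (T : ℝ) (φ : SpaceX Ω T) : ℝ → HNeg Ω :=
  fun t => L2toHNeg Ω (toL2 Ω (φ t))

/-- `Y = L²(0,T; H¹₀(Ω)) ∩ H¹(0,T; H⁻¹(Ω))`. -/
def SpaceY (Ω : Set (EuclideanSpace ℝ (Fin d))) (T : ℝ) : Set (SpaceX Ω T) :=
  {φ | MemH1Time (Ioo 0 T) (asHNeg Ω T φ)}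

/-- `∂ₜφ`, with values in `H⁻¹(Ω)`. -/
def dt (Ω : Set (EuclideanSpace ℝ (Fin d))) (T : ℝ) (φ : SpaceX Ω T) : ℝ → HNeg Ω :=
  weakTimeDeriv (Ioo 0 T) (asHNeg Ω T φ)

/-- `u` is a representative of `φ` in `C([0,T]; L²(Ω))`. -/
def IsContinuousRep (Ω : Set (EuclideanSpace ℝ (Fin d))) (T : ℝ) (φ : SpaceX Ω T)
    (u : ℝ → L2 Ω) : Prop :=
  ContinuousOn u (Icc 0 T) ∧ ∀ᵐ t ∂(volume.restrict (Ioo 0 T)), u t = toL2 Ω (φ t)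

open Classical in
/-- The continuous representative of `φ`; its value at `t ∈ [0,T]` is `φ(t) ∈ L²(Ω)`. -/
def valueAt (Ω : Set (EuclideanSpace ℝ (Fin d))) (T : ℝ) (φ : SpaceX Ω T) : ℝ → L2 Ω :=
  if h : ∃ u, IsContinuousRep Ω T φ u then h.choose else 0

/-- `‖φ‖_Y`, where `‖φ‖_Y² = ∫₀ᵀ (‖∂ₜφ‖²_{H⁻¹} + ‖∇φ‖²) dt + ‖φ(T)‖²`. -/
def normY (Ω : Set (EuclideanSpace ℝ (Fin d))) (T : ℝ) (φ : SpaceX Ω T) : ℝ :=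
  Real.sqrt ((∫ t in Ioo 0 T, (normHNeg Ω (dt Ω T φ t) ^ 2 + ‖grad Ω (φ t)‖ ^ 2))
    + ‖valueAt Ω T φ T‖ ^ 2)

/-- `B_Y(φ, v) = ∫₀ᵀ (⟨∂ₜφ, v⟩ + (∇φ, ∇v)_Ω) dt`. -/
def formBY (Ω : Set (EuclideanSpace ℝ (Fin d))) (T : ℝ) (φ v : SpaceX Ω T) : ℝ :=
  ∫ t in Ioo 0 T, (dt Ω T φ t (v t) + inner ℝ (grad Ω (φ t)) (grad Ω (v t)))

/-- The quotients `B_Y(φ, v) / ‖v‖_X`, `v ∈ X \ {0}`. -/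
def quotientsBY (Ω : Set (EuclideanSpace ℝ (Fin d))) (T : ℝ) (φ : SpaceX Ω T) : Set ℝ :=
  {r | ∃ v : SpaceX Ω T, v ≠ 0 ∧ r = formBY Ω T φ v / normX Ω T v}

end Parabolic

end

open scoped Topology

/-! The Poincaré inequality makes (∇u, ∇v)_Ω a coercive inner product on H¹₀(Ω), with a bounded
Riesz map R : H⁻¹ → H¹₀ (`exists_riesz`). Put z = R ∂ₜφ + φ ∈ X. Then B_Y(φ, v) is the integral over
time of (∇z, ∇v)_Ω, so by Cauchy–Schwarz, tested with v = z, the supremum is ‖z‖_X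
(`isLUB_inner_div_norm`). Pointwise in time, ‖∇z‖² = ‖∂ₜφ‖²_{H⁻¹} + ‖∇φ‖² + 2⟨∂ₜφ, φ⟩, and the cross
term integrates to ‖φ(T)‖² − ‖φ(0)‖².

That last integration, and the continuous representative it refers to, are the analytic core. They
are proved for an abstract bounded map i : V → H and without mollification. Write J x = (i x, i
·)_H. By du Bois-Reymond, J u is almost everywhere a primitive of its weak derivative w. Hence ‖i
u(t+h)‖² − ‖i u(t)‖² is the integral of w over the step, applied to u(t+h) + u(t). Integrate over t
∈ (a, b), divide by h and let h → 0: one side converges at Lebesgue points, the other by continuity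
of translation in L². This gives the energy identity on a set G of full measure
(`exists_energy_identity`). A local estimate then shows that i u is Cauchy along G at every point of
[0, T], so it extends continuously. -/

theorem MeasureTheory.MemLp.exists_extension {F : Type*} [NormedAddCommGroup F] {s : Set ℝ}
    (hs : MeasurableSet s) (hs' : volume s ≠ ⊤) {f : ℝ → F} (hf : MemLp f 2 (volume.restrict s)) :
    ∃ g : ℝ → F, Integrable g ∧ MemLp g 2 ∧ EqOn g f s := by
  have : IsFiniteMeasure (volume.restrict s) := ⟨by
    rw [Measure.restrict_apply_univ]; exact hs'.lt_top⟩
  have hf1 : IntegrableOn f s := hf.integrable (by norm_num)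
  exact ⟨s.indicator f, hf1.integrable_indicator hs, (memLp_indicator_iff_restrict hs).2 hf,
    fun t ht => indicator_of_mem ht f⟩

/-! ### Weak time derivatives and their primitives. -/

section WeakDerivative

variable {F : Type*} [NormedAddCommGroup F] [NormedSpace ℝ F]

/-- Fubini on the half-plane r ≤ t: the inner integral of θ' over [r, ∞) is −θ(r). -/
theorem integral_deriv_smul_primitive [CompleteSpace F] {w : ℝ → F} (hw : Integrable w)
    {θ : ℝ → ℝ} (hθ : ContDiff ℝ 1 θ) (hc : HasCompactSupport θ) :
    ∫ t, deriv θ t • (∫ r in Iic t, w r) = - ∫ r, θ r • w r := by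
  have hθi : Integrable (deriv θ) :=
    (hθ.continuous_deriv le_rfl).integrable_of_hasCompactSupport hc.deriv
  have hprod : Integrable (Function.uncurry fun t r => (Ici r).indicator (deriv θ) t • w r)
      (volume.prod volume) := by
    have h := (hθi.smul_prod hw).indicator
      (measurableSet_le measurable_snd measurable_fst : MeasurableSet {p : ℝ × ℝ | p.2 ≤ p.1})
    refine h.congr (Eventually.of_forall fun p => ?_)
    by_cases hp : p.2 ≤ p.1 <;> simp [Function.uncurry, indicator, hp]
  calc ∫ t, deriv θ t • (∫ r in Iic t, w r)
      = ∫ t, ∫ r, (Ici r).indicator (deriv θ) t • w r := by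
        refine integral_congr_ae (Eventually.of_forall fun t => ?_)
        simp only
        rw [← integral_smul, ← integral_indicator measurableSet_Iic]
        refine integral_congr_ae (Eventually.of_forall fun r => ?_)
        by_cases h : r ≤ t <;> simp [indicator, h]
    _ = ∫ r, ∫ t, (Ici r).indicator (deriv θ) t • w r := integral_integral_swap hprod
    _ = ∫ r, -(θ r • w r) := by
        refine integral_congr_ae (Eventually.of_forall fun r => ?_)
        simp only
        rw [integral_smul_const, integral_indicator measurableSet_Ici, integral_Ici_eq_integral_Ioi,
          hc.integral_Ioi_deriv_eq hθ, neg_smul]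
    _ = - ∫ r, θ r • w r := integral_neg _

theorem IsTestFunction.eq_zero_of_notMem {E : Type*} [NormedAddCommGroup E] [NormedSpace ℝ E]
    {U : Set E} {ψ : E → ℝ} (hψ : IsTestFunction U ψ) {x : E} (hx : x ∉ U) : ψ x = 0 :=
  image_eq_zero_of_notMem_tsupport fun h => hx (hψ.2.2 h)

theorem exists_isTestFunction_Ioo_integral_eq_one {a b : ℝ} (hab : a < b) :
    ∃ η : ℝ → ℝ, IsTestFunction (Ioo a b) η ∧ ∫ t, η t = 1 := by
  let f : ContDiffBump ((a + b) / 2) :=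
    ⟨(b - a) / 8, (b - a) / 4, by linarith, by linarith⟩
  refine ⟨f.normed volume, ⟨f.contDiff_normed, f.hasCompactSupport_normed, ?_⟩, f.integral_normed⟩
  rw [f.tsupport_normed_eq, Real.closedBall_eq_Icc]
  intro t ht
  simp only [f, mem_Icc] at ht
  constructor <;> linarith [ht.1, ht.2]

/-- The primitive of χ from a vanishes to the left of the support of χ, and the zero mean makes it
vanish to the right as well. -/
theorem IsTestFunction.exists_deriv_eq {a b : ℝ} {χ : ℝ → ℝ}
    (hχ : IsTestFunction (Ioo a b) χ) (h0 : ∫ t, χ t = 0) :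
    ∃ θ, IsTestFunction (Ioo a b) θ ∧ deriv θ = χ := by
  have hint : Integrable χ := hχ.1.continuous.integrable_of_hasCompactSupport hχ.2.1
  have hd : ∀ t, HasDerivAt (fun t => ∫ r in a..t, χ r) (χ t) t := fun t =>
    intervalIntegral.integral_hasDerivAt_right hint.intervalIntegrable
      (hχ.1.continuous.stronglyMeasurableAtFilter _ _) hχ.1.continuous.continuousAt
  have hderiv : deriv (fun t => ∫ r in a..t, χ r) = χ := funext fun t => (hd t).deriv
  refine ⟨fun t => ∫ r in a..t, χ r, ?_, hderiv⟩
  have hsmooth : ContDiff ℝ ∞ (fun t => ∫ r in a..t, χ r) :=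
    contDiff_infty_iff_deriv.2 ⟨fun t => (hd t).differentiableAt, by rw [hderiv]; exact hχ.1⟩
  rcases (tsupport χ).eq_empty_or_nonempty with he | hne
  · have hz : χ = 0 := tsupport_eq_empty_iff.1 he
    have : (fun t => ∫ r in a..t, χ r) = 0 := by ext t; simp [hz]
    rw [this]
    exact ⟨contDiff_const, HasCompactSupport.zero, by simp⟩
  obtain ⟨p, hp, hpl⟩ := hχ.2.1.isCompact.exists_isLeast hne
  obtain ⟨q, hq, hqg⟩ := hχ.2.1.isCompact.exists_isGreatest hne
  have hsub : tsupport (fun t => ∫ r in a..t, χ r) ⊆ Icc p q := by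
    refine closure_minimal (fun t ht => ?_) isClosed_Icc
    by_contra hcon
    apply ht
    have hout : ∀ r, (r < p ∨ q < r) → χ r = 0 := fun r hr =>
      image_eq_zero_of_notMem_tsupport fun h => by
        rcases hr with hr | hr
        · exact absurd (hpl h) (not_le.2 hr)
        · exact absurd (hqg h) (not_le.2 hr)
    have hpa := (hχ.2.2 hp).1
    rcases not_and_or.1 hcon with h | h
    · rw [not_le] at h
      refine intervalIntegral.integral_zero_ae (Eventually.of_forall fun r hr => hout r (Or.inl ?_))
      rcases le_total a t with hat | hat
      · rw [uIoc_of_le hat] at hr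
        exact hr.2.trans_lt h
      · rw [uIoc_of_ge hat] at hr
        exact hr.2.trans_lt hpa
    · rw [not_le] at h
      have hqa := (hχ.2.2 hq).1
      beta_reduce
      rw [intervalIntegral.integral_of_le (by linarith), setIntegral_eq_integral_of_forall_compl_eq_zero,
        h0]
      intro r hr
      simp only [mem_Ioc, not_and_or, not_lt, not_le] at hr
      exact hout r (hr.imp (fun h' => h'.trans_lt hpa) (fun h' => h.trans h'))
  exact ⟨hsmooth, HasCompactSupport.of_support_subset_isCompact isCompact_Icc
      ((subset_tsupport _).trans hsub),
    hsub.trans (Icc_subset_Ioo (hχ.2.2 hp).1 (hχ.2.2 hq).2)⟩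

theorem IsTestFunction.integrable_smul {I : Set ℝ} {ψ : ℝ → ℝ} (hψ : IsTestFunction I ψ)
    {μ : Measure ℝ} {κ : ℝ → F} (hκ : Integrable κ μ) : Integrable (fun t => ψ t • κ t) μ := by
  obtain ⟨C, hC⟩ := hψ.2.1.exists_bound_of_continuous hψ.1.continuous
  exact hκ.bdd_smul C hψ.1.continuous.aestronglyMeasurable (Eventually.of_forall hC)

/-- The lemma of du Bois-Reymond. -/
theorem ae_eq_const_of_integral_deriv_smul_eq_zero [CompleteSpace F] {a b : ℝ} (hab : a < b)
    {κ : ℝ → F} (hκ : IntegrableOn κ (Ioo a b))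
    (h : ∀ θ : ℝ → ℝ, IsTestFunction (Ioo a b) θ → ∫ t in Ioo a b, deriv θ t • κ t = 0) :
    ∃ c, ∀ᵐ t ∂(volume.restrict (Ioo a b)), κ t = c := by
  obtain ⟨η, hη, hη1⟩ := exists_isTestFunction_Ioo_integral_eq_one hab
  refine ⟨∫ t in Ioo a b, η t • κ t, ?_⟩
  set c := ∫ t in Ioo a b, η t • κ t with hc
  have hconst : IntegrableOn (fun _ : ℝ => c) (Ioo a b) := by simp
  have key := isOpen_Ioo.ae_eq_zero_of_integral_contDiff_smul_eq_zero (μ := volume)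
    (f := fun t => κ t - c) (U := Ioo a b) (hκ.sub hconst).locallyIntegrableOn ?_
  · rw [ae_restrict_iff' measurableSet_Ioo]
    filter_upwards [key] with t ht hti
    exact sub_eq_zero.1 (ht hti)
  intro ψ hψ1 hψ2 hψ3
  have hψ : IsTestFunction (Ioo a b) ψ := ⟨hψ1, hψ2, hψ3⟩
  have hψi : Integrable ψ := hψ1.continuous.integrable_of_hasCompactSupport hψ2
  have hηi : Integrable η := hη.1.continuous.integrable_of_hasCompactSupport hη.2.1
  set m := ∫ t, ψ t with hm
  -- Subtracting m η gives mean zero, so the result is the derivative of a test function and the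
  -- hypothesis applies to it.
  have hχ : IsTestFunction (Ioo a b) (fun t => ψ t - m * η t) := by
    refine ⟨hψ1.sub (contDiff_const.mul hη.1), hψ2.sub hη.2.1.mul_left, ?_⟩
    refine (tsupport_sub ψ (fun t => m * η t)).trans (union_subset hψ3 ?_)
    exact (tsupport_mul_subset_right (f := fun _ => m)).trans hη.2.2
  obtain ⟨θ, hθ, hθd⟩ := hχ.exists_deriv_eq (by
    rw [integral_sub hψi (hηi.const_mul m), integral_const_mul, hη1, ← hm]; ring)
  have h1 := h θ hθ
  rw [hθd] at h1
  have hψκ := hψ.integrable_smul hκ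
  have hηκ := hη.integrable_smul hκ
  have e1 : ∫ t in Ioo a b, (ψ t - m * η t) • κ t = (∫ t in Ioo a b, ψ t • κ t) - m • c := by
    rw [hc, ← integral_smul, ← integral_sub hψκ (hηκ.fun_smul m)]
    simp only [sub_smul, mul_smul]
  rw [← setIntegral_eq_integral_of_forall_compl_eq_zero (s := Ioo a b)]
  · have e2 : ∫ t in Ioo a b, ψ t = m :=
      setIntegral_eq_integral_of_forall_compl_eq_zero fun t ht => hψ.eq_zero_of_notMem ht
    simp only [smul_sub]
    rw [integral_sub hψκ (hψ.integrable_smul hconst), integral_smul_const, e2, ← e1, h1]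
  · intro t ht
    rw [hψ.eq_zero_of_notMem ht, zero_smul]

theorem IsWeakTimeDeriv.congr_deriv {I : Set ℝ} (hI : MeasurableSet I) {u w w' : ℝ → F}
    (h : IsWeakTimeDeriv I u w) (hw : EqOn w' w I) : IsWeakTimeDeriv I u w' := by
  intro θ hθ
  rw [h θ hθ]
  congr 1
  exact setIntegral_congr_fun hI fun t ht => by simp only [hw ht]

/-- A function with an integrable weak time derivative is almost everywhere a primitive of it. -/
theorem IsWeakTimeDeriv.ae_eq_const_add_integral [CompleteSpace F] {a b : ℝ} (hab : a < b)
    {u w : ℝ → F} (h : IsWeakTimeDeriv (Ioo a b) u w) (hu : IntegrableOn u (Ioo a b))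
    (hw : Integrable w) :
    ∃ c, ∀ᵐ t ∂(volume.restrict (Ioo a b)), u t = c + ∫ r in Iic t, w r := by
  have hW : Continuous fun t => ∫ r in Iic t, w r := by
    have : (fun t => ∫ r in Iic t, w r) = fun t =>
        (∫ r in Iic 0, w r) + ∫ r in (0 : ℝ)..t, w r := by
      ext t
      rw [← intervalIntegral.integral_Iic_sub_Iic hw.integrableOn hw.integrableOn]
      abel
    rw [this]
    exact continuous_const.add (hw.continuous_primitive 0)
  have hWi : IntegrableOn (fun t => ∫ r in Iic t, w r) (Ioo a b) :=
    (hW.integrableOn_Icc).mono_set Ioo_subset_Icc_self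
  -- The difference of u and the primitive of w has zero weak derivative.
  obtain ⟨c, hc⟩ := ae_eq_const_of_integral_deriv_smul_eq_zero hab (hu.sub hWi) (by
    intro θ hθ
    have hθ1 : ContDiff ℝ 1 θ := hθ.1.of_le (by exact_mod_cast le_top)
    have hdθ : IsTestFunction (Ioo a b) (deriv θ) :=
      ⟨(contDiff_infty_iff_deriv.1 hθ.1).2, hθ.2.1.deriv, (tsupport_deriv_subset).trans hθ.2.2⟩
    simp only [Pi.sub_apply, smul_sub]
    rw [integral_sub (hdθ.integrable_smul hu) (hdθ.integrable_smul hWi), h θ hθ,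
      setIntegral_eq_integral_of_forall_compl_eq_zero
        (f := fun t => deriv θ t • ∫ r in Iic t, w r),
      integral_deriv_smul_primitive hw hθ1 hθ.2.1, sub_neg_eq_add, neg_add_eq_zero]
    · exact setIntegral_eq_integral_of_forall_compl_eq_zero fun t ht => by
        rw [hθ.eq_zero_of_notMem ht, zero_smul]
    · intro t ht
      rw [hdθ.eq_zero_of_notMem ht, zero_smul])
  refine ⟨c, ?_⟩
  filter_upwards [hc] with t ht
  rw [← ht]
  simp

end WeakDerivative

/-! ### The energy identity by difference quotients. -/

section Energy

variable {V H : Type*} [NormedAddCommGroup V] [NormedSpace ℝ V]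
  [NormedAddCommGroup H] [InnerProductSpace ℝ H]

theorem MeasureTheory.MemLp.continuous_toLp_translate {E : Type*} [NormedAddCommGroup E]
    {f : ℝ → E} (hf : MemLp f 2) :
    Continuous fun c : ℝ => (hf.comp_measurePreserving (measurePreserving_vadd c volume)).toLp
      (fun t => f (c +ᵥ t)) := by
  have : Fact ((2 : ENNReal) ≠ ⊤) := ⟨by norm_num⟩
  have h : Continuous fun c : ℝ => DomAddAct.mk c +ᵥ hf.toLp f :=
    DomAddAct.continuous_mk.vadd continuous_const
  exact h

/-- The L² pairing is bounded and bilinear, and translation acts continuously on L². This is what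
allows passing to the limit in difference quotients when u and w have no pointwise regularity. -/
theorem continuous_integral_translate_apply {u : ℝ → V} {w : ℝ → StrongDual ℝ V}
    (hu : MemLp u 2) (hw : MemLp w 2) (s : Set ℝ) :
    Continuous fun p : ℝ × ℝ => ∫ t in s, w (p.1 + t) (u (p.2 + t)) := by
  let R {E : Type _} [NormedAddCommGroup E] [NormedSpace ℝ E] :
      Lp E 2 (volume : Measure ℝ) →L[ℝ] Lp E 2 (volume.restrict s) :=
    LpToLpRestrictCLM ℝ E ℝ volume 2 s
  let P := (ContinuousLinearMap.id ℝ (StrongDual ℝ V)).lpPairing (volume.restrict s) 2 2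
  have h : Continuous fun p : ℝ × ℝ =>
      P (R ((hw.comp_measurePreserving (measurePreserving_vadd p.1 volume)).toLp _))
        (R ((hu.comp_measurePreserving (measurePreserving_vadd p.2 volume)).toLp _)) :=
    ((P.continuous.comp (R.continuous.comp (hw.continuous_toLp_translate.comp
      continuous_fst)))).clm_apply
      (R.continuous.comp (hu.continuous_toLp_translate.comp continuous_snd))
  refine h.congr fun p => ?_
  rw [ContinuousLinearMap.lpPairing_eq_integral]
  refine integral_congr_ae ?_
  filter_upwards [LpToLpRestrictCLM_coeFn ℝ s
      ((hw.comp_measurePreserving (measurePreserving_vadd p.1 volume)).toLp _),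
    LpToLpRestrictCLM_coeFn ℝ s
      ((hu.comp_measurePreserving (measurePreserving_vadd p.2 volume)).toLp _),
    ae_restrict_of_ae (hw.comp_measurePreserving (measurePreserving_vadd p.1 volume)).coeFn_toLp,
    ae_restrict_of_ae (hu.comp_measurePreserving (measurePreserving_vadd p.2 volume)).coeFn_toLp]
    with t h1 h2 h3 h4
  simp only [R]
  rw [h1, h2, h3, h4]
  rfl

/-- The integrand itself moves with h, so this is not the derivative of a fixed primitive; joint
continuity at the origin controls both arguments at once. -/
theorem tendsto_inv_mul_integral_right {K : ℝ × ℝ → ℝ} (hK : Continuous K) :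
    Tendsto (fun h : ℝ => h⁻¹ * ∫ r in (0 : ℝ)..h, K (r, h)) (𝓝[>] 0) (𝓝 (K (0, 0))) := by
  rw [Metric.tendsto_nhdsWithin_nhds]
  intro ε hε
  obtain ⟨δ, hδ, hd⟩ := Metric.continuousAt_iff.1 (hK.continuousAt (x := (0, 0))) (ε / 2) (by positivity)
  refine ⟨δ, hδ, fun {h} hh hhd => ?_⟩
  have hh0 : 0 < h := hh
  have hhδ : h < δ := by simpa [Real.dist_eq, abs_of_pos hh0] using hhd
  have hb : ‖∫ r in (0 : ℝ)..h, (K (r, h) - K (0, 0))‖ ≤ ε / 2 * |h - 0| := by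
    refine intervalIntegral.norm_integral_le_of_norm_le_const fun r hr => ?_
    rw [uIoc_of_le hh0.le] at hr
    have : dist (r, h) ((0, 0) : ℝ × ℝ) < δ := by
      rw [Prod.dist_eq, max_lt_iff]
      simp only [Real.dist_eq, sub_zero, abs_of_pos hh0, abs_of_pos hr.1]
      exact ⟨hr.2.trans_lt hhδ, hhδ⟩
    exact (hd this).le
  have hc : Continuous fun r : ℝ => K (r, h) := hK.comp (by fun_prop)
  rw [intervalIntegral.integral_sub (hc.intervalIntegrable _ _) (by simp),
    intervalIntegral.integral_const, sub_zero, abs_of_pos hh0, smul_eq_mul, Real.norm_eq_abs] at hb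
  rw [Real.dist_eq]
  have e : h⁻¹ * (∫ r in (0 : ℝ)..h, K (r, h)) - K (0, 0)
      = h⁻¹ * ((∫ r in (0 : ℝ)..h, K (r, h)) - h * K (0, 0)) := by field_simp
  rw [e, abs_mul, abs_of_pos (inv_pos.2 hh0)]
  calc h⁻¹ * |(∫ r in (0 : ℝ)..h, K (r, h)) - h * K (0, 0)| ≤ h⁻¹ * (ε / 2 * h) := by gcongr
    _ = ε / 2 := by field_simp
    _ < ε := by linarith

/-- Fubini applies because the shear (t, r) ↦ (t, r + t) preserves measure and carries the
integrable product kernel to this one. -/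
theorem integral_integral_translate_apply_swap {v : ℝ → V} {w : ℝ → StrongDual ℝ V}
    (hv : Integrable v) (hw : Integrable w) (s s' : Set ℝ) :
    ∫ t in s, ∫ r in s', w (r + t) (v t) = ∫ r in s', ∫ t in s, w (r + t) (v t) := by
  have h1 : Integrable (fun p : ℝ × ℝ => w p.2 (v p.1)) (volume.prod volume) := by
    refine (hv.norm.mul_prod hw.norm).mono' ?_ (Eventually.of_forall fun p => ?_)
    · exact (ContinuousLinearMap.id ℝ (StrongDual ℝ V)).aestronglyMeasurable_comp₂
        hw.aestronglyMeasurable.comp_snd hv.aestronglyMeasurable.comp_fst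
    · rw [mul_comm]
      exact (w p.2).le_opNorm _
  have h2 := (measurePreserving_prod_add (volume : Measure ℝ) volume).integrable_comp_of_integrable h1
  refine integral_integral_swap ?_
  rw [Measure.prod_restrict]
  refine h2.restrict.congr (Eventually.of_forall fun p => ?_)
  simp [Function.uncurry, add_comm]

theorem MeasureTheory.MemLp.integrable_apply {α : Type*} [MeasurableSpace α] {μ : Measure α}
    {w : α → StrongDual ℝ V} {u : α → V} (hw : MemLp w 2 μ) (hu : MemLp u 2 μ) :
    Integrable (fun t => w t (u t)) μ := by
  refine (hw.norm.integrable_mul (q := 2) hu.norm).mono' ?_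
    (Eventually.of_forall fun t => (w t).le_opNorm _)
  exact (ContinuousLinearMap.id ℝ (StrongDual ℝ V)).aestronglyMeasurable_comp₂
    hw.aestronglyMeasurable hu.aestronglyMeasurable

/-- The factorisation x² − y² = (x − y)(x + y), valid because the form is symmetric. The difference
lands in the dual, where the primitive of w is available. -/
theorem norm_sq_sub_norm_sq_eq_apply (i : V →L[ℝ] H) (x y : V) :
    ‖i x‖ ^ 2 - ‖i y‖ ^ 2
      = ((innerSL ℝ (i x)).comp i - (innerSL ℝ (i y)).comp i) (x + y) := by
  simp only [sub_apply, ContinuousLinearMap.comp_apply, innerSL_apply_apply,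
    map_add, real_inner_self_eq_norm_sq, real_inner_comm (i x) (i y)]
  ring

theorem MeasureTheory.Integrable.apply_integral_Iic_sub {w : ℝ → StrongDual ℝ V} (hw : Integrable w)
    (v : V) (s t : ℝ) :
    ((∫ r in Iic t, w r) - ∫ r in Iic s, w r) v = ∫ r in s..t, w r v := by
  rw [intervalIntegral.integral_Iic_sub_Iic hw.integrableOn hw.integrableOn]
  have h : IntervalIntegrable w volume s t := hw.intervalIntegrable
  exact ContinuousLinearMap.intervalIntegral_apply h v

/-- The energy identity between almost all pairs of times. -/
theorem exists_energy_identity (i : V →L[ℝ] H) {u : ℝ → V} {w : ℝ → StrongDual ℝ V}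
    (hu1 : Integrable u) (hu2 : MemLp u 2) (hw1 : Integrable w) (hw2 : MemLp w 2)
    {T : ℝ} {c : StrongDual ℝ V}
    (hc : ∀ᵐ t ∂(volume.restrict (Ioo 0 T)),
      (innerSL ℝ (i (u t))).comp i = c + ∫ r in Iic t, w r) :
    ∃ G ⊆ Ioo 0 T, volume (Ioo 0 T \ G) = 0 ∧
      (∀ s ∈ G, ∀ t ∈ G, ∀ v, inner ℝ (i (u t)) (i v) - inner ℝ (i (u s)) (i v)
        = ∫ r in s..t, w r v) ∧
      ∀ s ∈ G, ∀ t ∈ G, ‖i (u t)‖ ^ 2 - ‖i (u s)‖ ^ 2 = 2 * ∫ r in s..t, w r (u r) := by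
  set F : ℝ → ℝ := fun t => ‖i (u t)‖ ^ 2 with hF
  have hFi : Integrable F := (hu2.continuousLinearMap_comp i).integrable_norm_pow (by norm_num)
  rw [ae_restrict_iff' measurableSet_Ioo] at hc
  have hD := LocallyIntegrable.ae_hasDerivAt_integral hFi.locallyIntegrable
  let P : ℝ → Prop := fun t => (t ∈ Ioo 0 T → (innerSL ℝ (i (u t))).comp i = c + ∫ r in Iic t, w r)
    ∧ HasDerivAt (fun x => ∫ t in (0 : ℝ)..x, F t) (F t) t
  have hP : ∀ᵐ t, P t := by
    filter_upwards [hc, hD] with t h1 h2 using ⟨h1, h2 0⟩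
  have key : ∀ s t, s ∈ Ioo 0 T → t ∈ Ioo 0 T → P s → P t → s ≤ t →
      F t - F s = 2 * ∫ r in s..t, w r (u r) := by
    intro a b ha hb hPa hPb hab
    -- K(r, h) is the integral over (a, b] of w(r+t) applied to u(h+t) + u(t). The difference of the
    -- slopes at b and a of the primitive of F is the mean of K(·, h) over (0, h), and K(0, 0) is
    -- the desired right-hand side.
    let K : ℝ × ℝ → ℝ := fun p => (∫ t in Ioc a b, w (p.1 + t) (u (p.2 + t)))
      + ∫ t in Ioc a b, w (p.1 + t) (u (0 + t))
    have hK : Continuous K := by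
      have h := continuous_integral_translate_apply hu2 hw2 (Ioc a b)
      exact h.add (h.comp (continuous_fst.prodMk continuous_const : Continuous fun p : ℝ × ℝ => (p.1, (0:ℝ))))
    have lim1 := tendsto_inv_mul_integral_right hK
    have lim2 := (hPb.2.tendsto_slope_zero_right).sub (hPa.2.tendsto_slope_zero_right)
    have hlim : F b - F a = K (0, 0) := by
      refine tendsto_nhds_unique (lim2.congr' ?_) lim1
      -- For h < T − b the shifted time t + h stays in (0, T), where the primitive formula holds.
      have hT : Ioo 0 (T - b) ∈ 𝓝[>] (0 : ℝ) := Ioo_mem_nhdsGT (by linarith [hb.2])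
      filter_upwards [hT] with h hh
      have hI : ∀ x y, IntervalIntegrable F volume x y := fun x y => hFi.intervalIntegrable
      have hFt : Integrable fun t => F (t + h) := hFi.comp_add_right h
      rw [smul_eq_mul, smul_eq_mul, ← mul_sub]
      congr 1
      have e1 : ((∫ t in (0:ℝ)..b + h, F t) - ∫ t in (0:ℝ)..b, F t)
          - ((∫ t in (0:ℝ)..a + h, F t) - ∫ t in (0:ℝ)..a, F t)
          = ∫ t in a..b, (F (t + h) - F t) := by
        rw [intervalIntegral.integral_sub hFt.intervalIntegrable (hI _ _),
          intervalIntegral.integral_comp_add_right,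
          ← intervalIntegral.integral_interval_sub_left (hI 0 (b + h)) (hI 0 (a + h)),
          ← intervalIntegral.integral_interval_sub_left (hI 0 b) (hI 0 a)]
        ring
      rw [e1, intervalIntegral.integral_of_le hab]
      have hut : Integrable fun t => u (h + t) := hu1.comp_add_left h
      have e2 : ∫ t in Ioc a b, (F (t + h) - F t)
          = ∫ t in Ioc a b, ∫ r in Ioc 0 h, w (r + t) (u (h + t) + u t) := by
        have hPh : ∀ᵐ t, P (t + h) :=
          (measurePreserving_add_right volume h).quasiMeasurePreserving.ae hP
        refine integral_congr_ae ?_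
        rw [EventuallyEq, ae_restrict_iff' measurableSet_Ioc]
        filter_upwards [hP, hPh] with t h1 h2 ht
        have m1 : t ∈ Ioo 0 T := ⟨ha.1.trans ht.1, ht.2.trans_lt hb.2⟩
        have m2 : t + h ∈ Ioo 0 T := ⟨by linarith [m1.1, hh.1], by linarith [hh.2, ht.2]⟩
        rw [hF]
        simp only
        rw [norm_sq_sub_norm_sq_eq_apply, h1.1 m1, h2.1 m2, add_sub_add_left_eq_sub,
          hw1.apply_integral_Iic_sub, ← intervalIntegral.integral_of_le hh.1.le,
          intervalIntegral.integral_comp_add_right (fun r => w r (u (h + t) + u t)), zero_add,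
          add_comm t h]
      rw [e2, integral_integral_translate_apply_swap (hut.fun_add hu1) hw1,
        intervalIntegral.integral_of_le hh.1.le]
      refine setIntegral_congr_fun measurableSet_Ioc fun r _ => ?_
      have m (p : ℝ) : Integrable (fun t => w (r + t) (u (p + t))) (volume.restrict (Ioc a b)) :=
        ((hw2.comp_measurePreserving (measurePreserving_add_left volume r)).integrable_apply
          (hu2.comp_measurePreserving (measurePreserving_add_left volume p))).restrict
      simp only [K]
      rw [← integral_add (m h) (m 0)]
      simp only [map_add, zero_add]
    rw [hlim, intervalIntegral.integral_of_le hab]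
    simp only [K, zero_add]
    ring
  refine ⟨{t | t ∈ Ioo 0 T ∧ P t}, fun t ht => ht.1, ?_, ?_, ?_⟩
  · refine measure_mono_null ?_ hP
    intro t ht hPt
    exact ht.2 ⟨ht.1, hPt⟩
  · intro s hs t ht v
    rw [← hw1.apply_integral_Iic_sub,
      ← add_sub_add_left_eq_sub (∫ r in Iic t, w r) _ c, ← ht.2.1 ht.1, ← hs.2.1 hs.1]
    simp
  · intro s hs t ht
    rcases le_total s t with h | h
    · exact key s t hs.1 ht.1 hs.2 ht.2 h
    · have := key t s ht.1 hs.1 ht.2 hs.2 h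
      rw [intervalIntegral.integral_symm]
      simp only [hF] at this
      linarith

end Energy

/-- The part of (0, T) outside the closure of G is open and null, hence empty. -/
theorem Icc_subset_closure_of_measure_diff_eq_zero {T : ℝ} (hT : 0 < T) {G : Set ℝ}
    (hG : volume (Ioo 0 T \ G) = 0) : Icc 0 T ⊆ closure G := by
  rw [← closure_Ioo hT.ne]
  refine closure_minimal ?_ isClosed_closure
  have h : volume (Ioo 0 T \ closure G) = 0 :=
    measure_mono_null (sdiff_subset_sdiff_right subset_closure) hG
  rw [(isOpen_Ioo.sdiff isClosed_closure).measure_eq_zero_iff volume] at h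
  exact sdiff_eq_empty.1 h

theorem abs_intervalIntegral_le_setIntegral {f g : ℝ → ℝ} {a b s t : ℝ} (hs : s ∈ Ioo a b)
    (ht : t ∈ Ioo a b) (hg : IntegrableOn g (Ioo a b)) (hfg : ∀ r, |f r| ≤ g r) :
    |∫ r in s..t, f r| ≤ ∫ r in Ioo a b, g r := by
  have hsub : uIoc s t ⊆ Ioo a b := uIoc_subset_uIcc.trans (ordConnected_Ioo.uIcc_subset hs ht)
  calc |∫ r in s..t, f r| ≤ ∫ r in uIoc s t, ‖f r‖ :=
        (Real.norm_eq_abs _).symm.le.trans intervalIntegral.norm_integral_le_integral_norm_uIoc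
    _ ≤ ∫ r in uIoc s t, g r := by
        refine integral_mono_of_nonneg (Eventually.of_forall fun r => norm_nonneg _)
          (hg.mono_set hsub) (Eventually.of_forall hfg)
    _ ≤ ∫ r in Ioo a b, g r :=
        setIntegral_mono_set hg (Eventually.of_forall fun r => (abs_nonneg _).trans (hfg r))
          hsub.eventuallyLE

/-! ### The continuous representative and integration by parts. -/

section Continuity

variable {V H : Type*} [NormedAddCommGroup V] [NormedSpace ℝ V]
  [NormedAddCommGroup H] [InnerProductSpace ℝ H]

/-- Expanding the square and using both identities gives 2∫ w(u) − 2∫ w(u(s)) over [s, t]. The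
second term involves ‖u(s)‖ in V, which is uncontrolled for general s; choosing s with ‖u(s)‖² at
most its average over (a, b) absorbs it into the integral of ‖u‖². -/
theorem exists_mem_forall_norm_sub_sq_le (i : V →L[ℝ] H) {u : ℝ → V} {w : ℝ → StrongDual ℝ V}
    (hu2 : MemLp u 2) (hw2 : MemLp w 2) {T : ℝ} {G : Set ℝ}
    (hG : volume (Ioo 0 T \ G) = 0)
    (h1 : ∀ s ∈ G, ∀ t ∈ G, ∀ v, inner ℝ (i (u t)) (i v) - inner ℝ (i (u s)) (i v)
        = ∫ r in s..t, w r v)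
    (h2 : ∀ s ∈ G, ∀ t ∈ G, ‖i (u t)‖ ^ 2 - ‖i (u s)‖ ^ 2 = 2 * ∫ r in s..t, w r (u r))
    {a b : ℝ} (hab : a < b) (h0a : 0 ≤ a) (hbT : b ≤ T) :
    ∃ s ∈ G, s ∈ Ioo a b ∧ ∀ t ∈ G, t ∈ Ioo a b →
      ‖i (u t) - i (u s)‖ ^ 2 ≤ 2 * ∫ r in Ioo a b, (‖w r‖ ^ 2 + ‖u r‖ ^ 2) := by
  have hwi : Integrable fun r => ‖w r‖ ^ 2 := hw2.integrable_norm_pow (by norm_num)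
  have hui : Integrable fun r => ‖u r‖ ^ 2 := hu2.integrable_norm_pow (by norm_num)
  have hμ : volume.restrict (Ioo a b) ≠ 0 := by
    rw [Ne, Measure.restrict_eq_zero, Real.volume_Ioo, ENNReal.ofReal_eq_zero]
    linarith
  have hN : volume.restrict (Ioo a b) (Gᶜ ∪ (Ioo a b)ᶜ) = 0 := by
    rw [measure_union_null_iff, Measure.restrict_apply' measurableSet_Ioo,
      Measure.restrict_apply' measurableSet_Ioo, compl_inter_self]
    refine ⟨measure_mono_null ?_ hG, measure_empty⟩
    exact fun t ht => ⟨⟨h0a.trans_lt ht.2.1, ht.2.2.trans_le hbT⟩, ht.1⟩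
  obtain ⟨s, hsN, hs⟩ := exists_notMem_null_le_average hμ hui.restrict hN
  rw [mem_union, not_or, notMem_compl_iff, notMem_compl_iff] at hsN
  refine ⟨s, hsN.1, hsN.2, fun t htG ht => ?_⟩
  have hs' : (b - a) * ‖u s‖ ^ 2 ≤ ∫ r in Ioo a b, ‖u r‖ ^ 2 := by
    rw [setAverage_eq, Real.volume_real_Ioo_of_le hab.le, smul_eq_mul] at hs
    rwa [le_inv_mul_iff₀ (by linarith)] at hs
  have hval : ∀ r v, |w r v| ≤ (‖w r‖ ^ 2 + ‖v‖ ^ 2) / 2 := fun r v => by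
    have := (w r).le_opNorm v
    rw [Real.norm_eq_abs] at this
    nlinarith [sq_nonneg (‖w r‖ - ‖v‖)]
  have b1 := abs_intervalIntegral_le_setIntegral (f := fun r => w r (u r)) hsN.2 ht
    (((hwi.add hui).div_const 2).integrableOn) (fun r => hval r (u r))
  have b2 := abs_intervalIntegral_le_setIntegral (f := fun r => w r (u s)) hsN.2 ht
    (g := fun r => (‖w r‖ ^ 2 + ‖u s‖ ^ 2) / 2)
    ((Integrable.fun_add hwi.restrict (integrable_const _)).div_const 2) (fun r => hval r (u s))
  have e1 : ∫ r in Ioo a b, (‖w r‖ ^ 2 + ‖u s‖ ^ 2) / 2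
      = ((∫ r in Ioo a b, ‖w r‖ ^ 2) + (b - a) * ‖u s‖ ^ 2) / 2 := by
    rw [integral_div, integral_add hwi.restrict (by simp), setIntegral_const,
      Real.volume_real_Ioo_of_le hab.le, smul_eq_mul]
  have e2 : ∫ r in Ioo a b, (‖w r‖ ^ 2 + ‖u r‖ ^ 2)
      = (∫ r in Ioo a b, ‖w r‖ ^ 2) + ∫ r in Ioo a b, ‖u r‖ ^ 2 :=
    integral_add hwi.restrict hui.restrict
  simp only [Pi.add_apply] at b1
  rw [integral_div, e2] at b1
  rw [e1] at b2
  rw [e2]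
  have e3 : ‖i (u t) - i (u s)‖ ^ 2
      = 2 * (∫ r in s..t, w r (u r)) - 2 * ∫ r in s..t, w r (u s) := by
    rw [← h2 s hsN.1 t htG, ← h1 s hsN.1 t htG, norm_sub_sq_real, real_inner_self_eq_norm_sq]
    ring
  rw [e3]
  linarith [le_abs_self (∫ r in s..t, w r (u r)), neg_abs_le (∫ r in s..t, w r (u s))]

theorem exists_tendsto_nhdsWithin [CompleteSpace H] (i : V →L[ℝ] H) {u : ℝ → V}
    {w : ℝ → StrongDual ℝ V} (hu2 : MemLp u 2) (hw2 : MemLp w 2) {T : ℝ} (hT : 0 < T) {G : Set ℝ}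
    (hGT : G ⊆ Ioo 0 T) (hG : volume (Ioo 0 T \ G) = 0)
    (h1 : ∀ s ∈ G, ∀ t ∈ G, ∀ v, inner ℝ (i (u t)) (i v) - inner ℝ (i (u s)) (i v)
        = ∫ r in s..t, w r v)
    (h2 : ∀ s ∈ G, ∀ t ∈ G, ‖i (u t)‖ ^ 2 - ‖i (u s)‖ ^ 2 = 2 * ∫ r in s..t, w r (u r))
    {t₀ : ℝ} (ht₀ : t₀ ∈ Icc 0 T) :
    ∃ y, Tendsto (fun t => i (u t)) (𝓝[G] t₀) (𝓝 y) := by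
  have : (𝓝[G] t₀).NeBot :=
    mem_closure_iff_nhdsWithin_neBot.1 (Icc_subset_closure_of_measure_diff_eq_zero hT hG ht₀)
  rw [← cauchy_map_iff_exists_tendsto, Metric.cauchy_iff]
  refine ⟨inferInstance, fun ε hε => ?_⟩
  have hm : Integrable fun r => ‖w r‖ ^ 2 + ‖u r‖ ^ 2 :=
    (hw2.integrable_norm_pow (by norm_num)).add (hu2.integrable_norm_pow (by norm_num))
  have hM := hm.continuous_primitive 0
  -- The energy in a shrinking window around t₀ tends to zero.
  have hω : Tendsto (fun δ : ℝ => (∫ r in (0 : ℝ)..(t₀ + δ), (‖w r‖ ^ 2 + ‖u r‖ ^ 2))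
      - ∫ r in (0 : ℝ)..(t₀ - δ), (‖w r‖ ^ 2 + ‖u r‖ ^ 2)) (𝓝[>] 0) (𝓝 0) := by
    have hc : Continuous (fun δ : ℝ => (∫ r in (0 : ℝ)..(t₀ + δ), (‖w r‖ ^ 2 + ‖u r‖ ^ 2))
      - ∫ r in (0 : ℝ)..(t₀ - δ), (‖w r‖ ^ 2 + ‖u r‖ ^ 2)) :=
      (hM.comp (continuous_const.add continuous_id)).sub
        (hM.comp (continuous_const.sub continuous_id))
    have := (hc.tendsto 0).mono_left (nhdsWithin_le_nhds (s := Ioi 0))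
    simpa using this
  obtain ⟨δ, hδlt, hδ⟩ := ((hω.eventually (gt_mem_nhds (show 0 < (ε / 2) ^ 2 / 2 by positivity))).and
    self_mem_nhdsWithin).exists
  have hδ0 : 0 < δ := hδ
  -- Cutting the window to (0, T) covers t₀ = 0 and t₀ = T by the same argument.
  obtain ⟨s, hsG, hs, hst⟩ := exists_mem_forall_norm_sub_sq_le i hu2 hw2 hG h1 h2
    (a := max 0 (t₀ - δ)) (b := min T (t₀ + δ))
    (by simp only [max_lt_iff, lt_min_iff]
        exact ⟨⟨hT, by linarith [ht₀.2]⟩, by linarith [ht₀.1], by linarith⟩)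
    (le_max_left _ _) (min_le_left _ _)
  have hJ : ∫ r in Ioo (max 0 (t₀ - δ)) (min T (t₀ + δ)), (‖w r‖ ^ 2 + ‖u r‖ ^ 2)
      < (ε / 2) ^ 2 / 2 := by
    refine lt_of_le_of_lt ?_ hδlt
    rw [intervalIntegral.integral_interval_sub_left hm.intervalIntegrable hm.intervalIntegrable,
      intervalIntegral.integral_of_le (by linarith)]
    refine setIntegral_mono_set hm.integrableOn (Eventually.of_forall fun r => ?_)
      (LE.le.eventuallyLE fun r hr => ⟨(le_max_right _ _).trans_lt hr.1,
        (hr.2.trans_le (min_le_right _ _)).le⟩)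
    simp only [Pi.zero_apply]
    positivity
  have hclose : ∀ t ∈ G ∩ Ioo (t₀ - δ) (t₀ + δ), dist (i (u t)) (i (u s)) < ε / 2 := by
    intro t ht
    have := hst t ht.1 ⟨max_lt (hGT ht.1).1 ht.2.1, lt_min (hGT ht.1).2 ht.2.2⟩
    rw [dist_eq_norm]
    exact lt_of_pow_lt_pow_left₀ 2 (by positivity) (by linarith)
  refine ⟨(fun t => i (u t)) '' (G ∩ Ioo (t₀ - δ) (t₀ + δ)), image_mem_map
    (inter_mem self_mem_nhdsWithin (mem_nhdsWithin_of_mem_nhds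
      (Ioo_mem_nhds (by linarith) (by linarith)))), ?_⟩
  rintro _ ⟨t, ht, rfl⟩ _ ⟨t', ht', rfl⟩
  calc dist (i (u t)) (i (u t')) ≤ dist (i (u t)) (i (u s)) + dist (i (u t')) (i (u s)) :=
        dist_triangle_right _ _ _
    _ < ε := by linarith [hclose t ht, hclose t' ht']

theorem IsWeakTimeDeriv.exists_energy_identity (i : V →L[ℝ] H) {T : ℝ} (hT : 0 < T)
    {u : ℝ → V} {w : ℝ → StrongDual ℝ V} (hu : MemLp u 2 (volume.restrict (Ioo 0 T)))
    (hw : MemLp w 2 (volume.restrict (Ioo 0 T)))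
    (h : IsWeakTimeDeriv (Ioo 0 T) (fun t => (innerSL ℝ (i (u t))).comp i) w) :
    ∃ (u' : ℝ → V) (w' : ℝ → StrongDual ℝ V), MemLp u' 2 ∧ MemLp w' 2 ∧
      EqOn u' u (Ioo 0 T) ∧ EqOn w' w (Ioo 0 T) ∧ ∃ G ⊆ Ioo 0 T, volume (Ioo 0 T \ G) = 0 ∧
        (∀ s ∈ G, ∀ t ∈ G, ∀ v, inner ℝ (i (u' t)) (i v) - inner ℝ (i (u' s)) (i v)
          = ∫ r in s..t, w' r v) ∧
        ∀ s ∈ G, ∀ t ∈ G, ‖i (u' t)‖ ^ 2 - ‖i (u' s)‖ ^ 2 = 2 * ∫ r in s..t, w' r (u' r) := by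
  have hfin : volume (Ioo 0 T) ≠ ⊤ := by simp
  -- Extension to the whole line makes all translates meaningful; only values on (0, T) enter the
  -- identities.
  obtain ⟨u', hu1, hu2, huu⟩ := hu.exists_extension measurableSet_Ioo hfin
  obtain ⟨w', hw1, hw2, hww⟩ := hw.exists_extension measurableSet_Ioo hfin
  have hJ : IntegrableOn (fun t => (innerSL ℝ (i (u t))).comp i) (Ioo 0 T) :=
    (((ContinuousLinearMap.compL ℝ V H ℝ).flip i).comp ((innerSL ℝ).comp i)).integrable_comp
      (hu.integrable (by norm_num))
  obtain ⟨c, hc⟩ := (h.congr_deriv measurableSet_Ioo hww).ae_eq_const_add_integral hT hJ hw1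
  refine ⟨u', w', hu2, hw2, huu, hww,
    _root_.exists_energy_identity i hu1 hu2 hw1 hw2 (c := c) ?_⟩
  filter_upwards [hc, ae_restrict_mem measurableSet_Ioo] with t ht htm
  rw [huu htm, ht]

theorem IsWeakTimeDeriv.exists_continuousOn [CompleteSpace H] (i : V →L[ℝ] H) {T : ℝ} (hT : 0 < T)
    {u : ℝ → V} {w : ℝ → StrongDual ℝ V} (hu : MemLp u 2 (volume.restrict (Ioo 0 T)))
    (hw : MemLp w 2 (volume.restrict (Ioo 0 T)))
    (h : IsWeakTimeDeriv (Ioo 0 T) (fun t => (innerSL ℝ (i (u t))).comp i) w) :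
    ∃ U : ℝ → H, ContinuousOn U (Icc 0 T) ∧
      ∀ᵐ t ∂(volume.restrict (Ioo 0 T)), U t = i (u t) := by
  obtain ⟨u', w', hu2, hw2, huu, hww, G, hGT, hG, h1, h2⟩ := h.exists_energy_identity i hT hu hw
  have hcl := Icc_subset_closure_of_measure_diff_eq_zero hT hG
  have hlim : ∀ t₀ ∈ Icc 0 T, ∃ y,
      Tendsto (fun t => i (u' t)) (𝓝[G] t₀) (𝓝 y) := fun t₀ ht₀ =>
    exists_tendsto_nhdsWithin i hu2 hw2 hT hGT hG h1 h2 ht₀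
  refine ⟨extendFrom G fun t => i (u' t), continuousOn_extendFrom hcl hlim, ?_⟩
  rw [ae_restrict_iff' measurableSet_Ioo]
  filter_upwards [show ∀ᵐ t, t ∉ Ioo 0 T \ G from measure_eq_zero_iff_ae_notMem.1 hG] with t ht htm
  have htG : t ∈ G := by
    by_contra hcon
    exact ht ⟨htm, hcon⟩
  obtain ⟨y, hy⟩ := hlim t (Ioo_subset_Icc_self htm)
  -- Since t itself lies in G, the limit along G must equal the value at t.
  have hy' := tendsto_nhds_unique
    (tendsto_const_nhds.congr' (f₁ := fun _ => i (u' t)) (by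
      simp [EventuallyEq])) (hy.mono_left (pure_le_nhdsWithin htG))
  rw [extendFrom_eq (subset_closure htG) hy, ← hy', huu htm]

/-- Integration by parts in time for a continuous representative. -/
theorem IsWeakTimeDeriv.norm_sq_sub_norm_sq (i : V →L[ℝ] H) {T : ℝ} (hT : 0 < T)
    {u : ℝ → V} {w : ℝ → StrongDual ℝ V} (hu : MemLp u 2 (volume.restrict (Ioo 0 T)))
    (hw : MemLp w 2 (volume.restrict (Ioo 0 T)))
    (h : IsWeakTimeDeriv (Ioo 0 T) (fun t => (innerSL ℝ (i (u t))).comp i) w)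
    {U : ℝ → H} (hU : ContinuousOn U (Icc 0 T))
    (hUu : ∀ᵐ t ∂(volume.restrict (Ioo 0 T)), U t = i (u t)) :
    ‖U T‖ ^ 2 - ‖U 0‖ ^ 2 = 2 * ∫ t in Ioo 0 T, w t (u t) := by
  obtain ⟨u', w', hu2, hw2, huu, hww, G, hGT, hG, -, h2⟩ := h.exists_energy_identity i hT hu hw
  -- On G' the energy identity is one for U. Both endpoints are limits of G', so s → 0 and t → T
  -- along G' yield the claim.
  set G' := {t ∈ G | U t = i (u t)} with hG'def
  have hG' : volume (Ioo 0 T \ G') = 0 := by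
    rw [ae_restrict_iff' measurableSet_Ioo] at hUu
    refine measure_mono_null (t := (Ioo 0 T \ G) ∪ {t | ¬ (t ∈ Ioo 0 T → U t = i (u t))}) ?_
      (measure_union_null hG hUu)
    intro t ht
    by_cases htG : t ∈ G
    · exact Or.inr fun hcon => ht.2 ⟨htG, hcon ht.1⟩
    · exact Or.inl ⟨ht.1, htG⟩
  have hG'T : G' ⊆ Icc 0 T := fun t ht => Ioo_subset_Icc_self (hGT ht.1)
  have hcl := Icc_subset_closure_of_measure_diff_eq_zero hT hG'
  have n0 : (𝓝[G'] (0 : ℝ)).NeBot := mem_closure_iff_nhdsWithin_neBot.1 (hcl ⟨le_rfl, hT.le⟩)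
  have nT : (𝓝[G'] T).NeBot := mem_closure_iff_nhdsWithin_neBot.1 (hcl ⟨hT.le, le_rfl⟩)
  have c0 : Tendsto U (𝓝[G'] 0) (𝓝 (U 0)) := (hU 0 ⟨le_rfl, hT.le⟩).mono hG'T
  have cT : Tendsto U (𝓝[G'] T) (𝓝 (U T)) := (hU T ⟨hT.le, le_rfl⟩).mono hG'T
  have hint := hw2.integrable_apply hu2
  have hprim := hint.continuous_primitive 0
  have L1 : Tendsto (fun p : ℝ × ℝ => ‖U p.2‖ ^ 2 - ‖U p.1‖ ^ 2) (𝓝[G'] 0 ×ˢ 𝓝[G'] T)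
      (𝓝 (‖U T‖ ^ 2 - ‖U 0‖ ^ 2)) :=
    ((cT.comp tendsto_snd).norm.pow 2).sub ((c0.comp tendsto_fst).norm.pow 2)
  have L2 : Tendsto (fun p : ℝ × ℝ => 2 *
      ((∫ r in (0 : ℝ)..p.2, w' r (u' r))
        - ∫ r in (0 : ℝ)..p.1, w' r (u' r)))
      (𝓝[G'] 0 ×ˢ 𝓝[G'] T)
      (𝓝 (2 * ((∫ r in (0 : ℝ)..T, w' r (u' r))
        - ∫ r in (0 : ℝ)..0, w' r (u' r)))) :=
    ((((hprim.tendsto T).mono_left nhdsWithin_le_nhds).comp tendsto_snd).sub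
      (((hprim.tendsto 0).mono_left nhdsWithin_le_nhds).comp tendsto_fst)).const_mul 2
  have hE := tendsto_nhds_unique (L1.congr' ?_) L2
  · rw [hE, intervalIntegral.integral_same, sub_zero, intervalIntegral.integral_of_le hT.le,
      integral_Ioc_eq_integral_Ioo]
    congr 1
    refine setIntegral_congr_fun measurableSet_Ioo fun t ht => ?_
    simp only [huu ht, hww ht]
  · filter_upwards [prod_mem_prod self_mem_nhdsWithin self_mem_nhdsWithin] with p hp
    rw [intervalIntegral.integral_interval_sub_left hint.intervalIntegrable hint.intervalIntegrable,
      ← h2 _ hp.1.1 _ hp.2.1, hp.1.2, hp.2.2, huu (hGT hp.1.1),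
      huu (hGT hp.2.1)]

end Continuity

/-! ### Sobolev spaces: completeness, the Poincaré inequality, nontriviality. -/

section L2

variable {α E : Type*} [MeasurableSpace α] {μ : Measure α}
  [NormedAddCommGroup E] [InnerProductSpace ℝ E]

theorem MeasureTheory.Lp.norm_sq_eq_integral (f : Lp E 2 μ) : ‖f‖ ^ 2 = ∫ x, ‖f x‖ ^ 2 ∂μ := by
  rw [← real_inner_self_eq_norm_sq, L2.inner_def]
  simp only [real_inner_self_eq_norm_sq]

theorem MeasureTheory.MemLp.continuous_integral_mul {χ : α → ℝ} (hχ : MemLp χ 2 μ) :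
    Continuous fun f : Lp ℝ 2 μ => ∫ x, f x * χ x ∂μ := by
  have h : Continuous fun f : Lp ℝ 2 μ => inner ℝ (hχ.toLp χ) f :=
    continuous_const.inner continuous_id
  refine h.congr fun f => ?_
  rw [L2.inner_def]
  refine integral_congr_ae ?_
  filter_upwards [hχ.coeFn_toLp] with x hx
  rw [hx]
  simp

end L2

section Sobolev

variable {d : ℕ} {Ω : Set (EuclideanSpace ℝ (Fin d))}

theorem IsTestFunction.memLp {ψ : EuclideanSpace ℝ (Fin d) → ℝ} (hψ : IsTestFunction Ω ψ) :
    MemLp ψ 2 (volume.restrict Ω) :=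
  hψ.1.continuous.memLp_of_hasCompactSupport hψ.2.1

/-- Each defining identity equates two L² pairings with fixed test functions, a closed condition.
The resulting completeness of H¹₀(Ω) is needed for Lax–Milgram. -/
theorem isClosed_H1Submodule (Ω : Set (EuclideanSpace ℝ (Fin d))) :
    IsClosed (H1Submodule Ω : Set (WithLp 2 (L2 Ω × L2Vec Ω))) := by
  have h : (H1Submodule Ω : Set (WithLp 2 (L2 Ω × L2Vec Ω))) =
      ⋂ (i : Fin d) (ψ : EuclideanSpace ℝ (Fin d) → ℝ) (_ : IsTestFunction Ω ψ),
        {w | ∫ x in Ω, w.fst x * fderiv ℝ ψ x (EuclideanSpace.single i 1)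
          = - ∫ x in Ω, w.snd x i * ψ x} := by
    ext w
    simp only [mem_iInter]
    rfl
  rw [h]
  refine isClosed_iInter fun i => isClosed_iInter fun ψ => isClosed_iInter fun hψ => ?_
  refine isClosed_eq ?_ ?_
  · exact (hψ.fderiv_apply _).memLp.continuous_integral_mul.comp
      (WithLp.fstL 2 ℝ (L2 Ω) (L2Vec Ω)).continuous
  · have hc : Continuous fun g : L2Vec Ω => ∫ x in Ω, g x i * ψ x := by
      refine (hψ.memLp.continuous_integral_mul.comp
        ((EuclideanSpace.proj (𝕜 := ℝ) i).compLpL 2 (volume.restrict Ω)).continuous).congr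
        fun g => integral_congr_ae ?_
      filter_upwards [(EuclideanSpace.proj (𝕜 := ℝ) i).coeFn_compLpL (p := 2) g] with x hx
      rw [hx]
      rfl
    exact (hc.comp (WithLp.sndL 2 ℝ (L2 Ω) (L2Vec Ω)).continuous).neg

instance (Ω : Set (EuclideanSpace ℝ (Fin d))) : CompleteSpace (H1 Ω) :=
  (isClosed_H1Submodule Ω).completeSpace_coe

instance (Ω : Set (EuclideanSpace ℝ (Fin d))) : CompleteSpace (H10 Ω) :=
  (Submodule.isClosed_topologicalClosure _).completeSpace_coe

theorem norm_sq_H10 (v : H10 Ω) : ‖v‖ ^ 2 = ‖toL2 Ω v‖ ^ 2 + ‖grad Ω v‖ ^ 2 :=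
  WithLp.prod_norm_sq_eq_of_L2 (H1.incl Ω (H10.incl Ω v))

theorem setIntegral_mul_fderiv {ψ χ : EuclideanSpace ℝ (Fin d) → ℝ} (hψ : IsTestFunction Ω ψ)
    (hχ : IsTestFunction Ω χ) (e : EuclideanSpace ℝ (Fin d)) :
    ∫ x in Ω, ψ x * fderiv ℝ χ x e = - ∫ x in Ω, fderiv ℝ ψ x e * χ x := by
  have hi {f g : EuclideanSpace ℝ (Fin d) → ℝ} (hf : IsTestFunction Ω f) (hg : IsTestFunction Ω g) :
      Integrable fun x => f x * g x :=
    (hf.1.continuous.mul hg.1.continuous).integrable_of_hasCompactSupport hf.2.1.mul_right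
  rw [setIntegral_eq_integral_of_forall_compl_eq_zero, setIntegral_eq_integral_of_forall_compl_eq_zero]
  · exact integral_mul_fderiv_eq_neg_fderiv_mul_of_integrable (hi (hψ.fderiv_apply e) hχ)
      (hi hψ (hχ.fderiv_apply e)) (hi hψ hχ)
      (fun x _ => (hψ.1.differentiable (by simp)) x) (fun x _ => (hχ.1.differentiable (by simp)) x)
  · intro x hx
    rw [hχ.eq_zero_of_notMem hx, mul_zero]
  · intro x hx
    rw [hψ.eq_zero_of_notMem hx, zero_mul]

theorem IsTestFunction.coord_mul {ψ : EuclideanSpace ℝ (Fin d) → ℝ} (hψ : IsTestFunction Ω ψ)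
    (i : Fin d) : IsTestFunction Ω (fun x => x i * ψ x) :=
  ⟨(EuclideanSpace.proj (𝕜 := ℝ) i).contDiff.mul hψ.1, hψ.2.1.mul_left,
    (tsupport_mul_subset_right (f := fun x : EuclideanSpace ℝ (Fin d) => x i)).trans hψ.2.2⟩

theorem IsTestFunction.fderiv_coord_mul {ψ : EuclideanSpace ℝ (Fin d) → ℝ}
    (hψ : IsTestFunction Ω ψ) (i : Fin d) (x : EuclideanSpace ℝ (Fin d)) :
    fderiv ℝ (fun x => x i * ψ x) x (EuclideanSpace.single i 1)
      = x i * fderiv ℝ ψ x (EuclideanSpace.single i 1) + ψ x := by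
  have h := ((EuclideanSpace.proj (𝕜 := ℝ) i).hasFDerivAt (x := x)).mul
    ((hψ.1.differentiable (by simp)) x).hasFDerivAt
  have h' : HasFDerivAt (fun x : EuclideanSpace ℝ (Fin d) => x i * ψ x) _ x := h
  rw [h'.fderiv]
  simp

/-- The Poincaré inequality for functions that agree with a test function. -/
theorem norm_fst_sq_le_of_isTestFunction (hd : 1 ≤ d) {R : ℝ} (hR : ∀ x ∈ Ω, ‖x‖ ≤ R)
    (hΩ : MeasurableSet Ω) (w : H1 Ω) {ψ : EuclideanSpace ℝ (Fin d) → ℝ} (hψ : IsTestFunction Ω ψ)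
    (hw : ∀ᵐ x ∂(volume.restrict Ω), (H1.incl Ω w).fst x = ψ x) :
    ‖(H1.incl Ω w).fst‖ ^ 2 ≤ 4 * R ^ 2 * ‖(H1.incl Ω w).snd‖ ^ 2 := by
  let i : Fin d := ⟨0, hd⟩
  set e : EuclideanSpace ℝ (Fin d) := EuclideanSpace.single i 1 with he
  -- Testing the weak gradient with xᵢψ gives I + ‖ψ‖² = −∫ gᵢ xᵢ ψ, where I = ∫ xᵢ ψ ∂ᵢψ; parts for
  -- ψ alone give I = −‖ψ‖²/2. The gradient g need not be identified with ∇ψ.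
  have hχ := hψ.coord_mul i
  have hweak : ∫ x in Ω, (H1.incl Ω w).fst x * fderiv ℝ (fun x => x i * ψ x) x e
      = - ∫ x in Ω, (H1.incl Ω w).snd x i * (x i * ψ x) := w.2 i _ hχ
  have hu : ‖(H1.incl Ω w).fst‖ ^ 2 = ∫ x in Ω, ψ x * ψ x := by
    rw [Lp.norm_sq_eq_integral]
    refine integral_congr_ae ?_
    filter_upwards [hw] with x hx
    rw [hx, Real.norm_eq_abs, sq_abs, sq]
  have hparts := setIntegral_mul_fderiv hχ hψ e
  have i1 : Integrable (fun x => ψ x * ψ x) (volume.restrict Ω) := hψ.integrable_mul hψ.memLp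
  have i2 : Integrable (fun x => x i * ψ x * fderiv ℝ ψ x e) (volume.restrict Ω) :=
    (hψ.fderiv_apply e).integrable_mul hχ.memLp
  have e1 : ∫ x in Ω, (H1.incl Ω w).fst x * fderiv ℝ (fun x => x i * ψ x) x e
      = (∫ x in Ω, x i * ψ x * fderiv ℝ ψ x e) + ∫ x in Ω, ψ x * ψ x := by
    rw [← integral_add i2 i1]
    refine integral_congr_ae ?_
    filter_upwards [hw] with x hx
    rw [hx, hψ.fderiv_coord_mul]
    ring
  have e2 : ∫ x in Ω, fderiv ℝ (fun x => x i * ψ x) x e * ψ x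
      = (∫ x in Ω, x i * ψ x * fderiv ℝ ψ x e) + ∫ x in Ω, ψ x * ψ x := by
    rw [← integral_add i2 i1]
    refine integral_congr_ae (Eventually.of_forall fun x => ?_)
    simp only
    rw [hψ.fderiv_coord_mul]
    ring
  have hg : Integrable (fun x => ‖(H1.incl Ω w).snd x‖ ^ 2) (volume.restrict Ω) :=
    (Lp.memLp _).integrable_norm_pow (by norm_num)
  -- Young's inequality with weight 1/4 leaves ‖ψ‖²/4 on the left, whence the constant 4R².
  have hbound : - ∫ x in Ω, (H1.incl Ω w).snd x i * (x i * ψ x)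
      ≤ R ^ 2 * ‖(H1.incl Ω w).snd‖ ^ 2 + (∫ x in Ω, ψ x * ψ x) / 4 := by
    rw [Lp.norm_sq_eq_integral, ← integral_const_mul, ← integral_div, ← integral_neg,
      ← integral_add (hg.const_mul _) (i1.div_const 4)]
    refine integral_mono_ae (hχ.integrable_mul (memLp_coord _ i)).neg
      ((hg.const_mul _).add (i1.div_const 4)) ?_
    filter_upwards [ae_restrict_mem hΩ] with x hx
    have h1 : |(H1.incl Ω w).snd x i| ≤ ‖(H1.incl Ω w).snd x‖ :=
      (Real.norm_eq_abs _).symm.le.trans (PiLp.norm_apply_le _ i)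
    have h2 : |x i| ≤ R := (PiLp.norm_apply_le x i).trans (hR x hx)
    have h3 : ((H1.incl Ω w).snd x i * x i) ^ 2 ≤ R ^ 2 * ‖(H1.incl Ω w).snd x‖ ^ 2 := by
      rw [mul_pow, mul_comm, ← sq_abs (x i), ← sq_abs ((H1.incl Ω w).snd x i)]
      gcongr
    nlinarith [sq_nonneg ((H1.incl Ω w).snd x i * x i + ψ x / 2)]
  rw [e1] at hweak
  rw [e2] at hparts
  rw [hu]
  linarith

/-- The Poincaré inequality on `H¹₀(Ω)`. -/
theorem exists_norm_toL2_sq_le (hd : 1 ≤ d) (hΩ : MeasurableSet Ω)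
    (hb : Bornology.IsBounded Ω) :
    ∃ C : ℝ, 0 ≤ C ∧ ∀ v : H10 Ω, ‖toL2 Ω v‖ ^ 2 ≤ C * ‖grad Ω v‖ ^ 2 := by
  obtain ⟨R, hR⟩ := hb.exists_norm_le
  refine ⟨4 * R ^ 2, by positivity, fun v => ?_⟩
  let S : Set (H1 Ω) := {w | ‖(H1.incl Ω w).fst‖ ^ 2 ≤ 4 * R ^ 2 * ‖(H1.incl Ω w).snd‖ ^ 2}
  have hS : IsClosed S := by
    refine isClosed_le ?_ ?_
    · exact (((WithLp.fstL 2 ℝ (L2 Ω) (L2Vec Ω)).comp (H1.incl Ω)).continuous.norm).pow 2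
    · exact continuous_const.mul
        ((((WithLp.sndL 2 ℝ (L2 Ω) (L2Vec Ω)).comp (H1.incl Ω)).continuous.norm).pow 2)
  have hspan : ∀ w ∈ Submodule.span ℝ {w : H1 Ω | ∃ ψ, IsTestFunction Ω ψ ∧
      ∀ᵐ x ∂(volume.restrict Ω), (H1.incl Ω w).fst x = ψ x},
      ∃ ψ, IsTestFunction Ω ψ ∧ ∀ᵐ x ∂(volume.restrict Ω), (H1.incl Ω w).fst x = ψ x := by
    intro w hw
    induction hw using Submodule.span_induction with
    | mem w hw => exact hw
    | zero =>
      refine ⟨0, ⟨contDiff_const, HasCompactSupport.zero, by simp⟩, ?_⟩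
      exact Lp.coeFn_zero _ _ _
    | add a b _ _ ha hb =>
      obtain ⟨ψ, hψ, h1⟩ := ha
      obtain ⟨χ, hχ, h2⟩ := hb
      refine ⟨ψ + χ, ⟨hψ.1.add hχ.1, hψ.2.1.add hχ.2.1,
        (tsupport_add ψ χ).trans (union_subset hψ.2.2 hχ.2.2)⟩, ?_⟩
      have e1 : ∀ᵐ x ∂(volume.restrict Ω), (H1.incl Ω (a + b)).fst x
          = (H1.incl Ω a).fst x + (H1.incl Ω b).fst x := Lp.coeFn_add _ _
      filter_upwards [e1, h1, h2] with x h3 h4 h5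
      rw [h3, h4, h5, Pi.add_apply]
    | smul c a _ ha =>
      obtain ⟨ψ, hψ, h1⟩ := ha
      refine ⟨fun x => c * ψ x, ⟨contDiff_const.mul hψ.1, hψ.2.1.mul_left,
        (tsupport_mul_subset_right (f := fun _ => c)).trans hψ.2.2⟩, ?_⟩
      have e1 : ∀ᵐ x ∂(volume.restrict Ω), (H1.incl Ω (c • a)).fst x
          = c * (H1.incl Ω a).fst x := Lp.coeFn_smul c _
      filter_upwards [e1, h1] with x h3 h4
      rw [h3, h4]
  have hsub : (H10Submodule Ω : Set (H1 Ω)) ⊆ S := by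
    rw [H10Submodule, Submodule.topologicalClosure_coe]
    refine closure_minimal (fun w hw => ?_) hS
    obtain ⟨ψ, hψ, h⟩ := hspan w hw
    exact norm_fst_sq_le_of_isTestFunction hd hR hΩ w hψ h
  exact hsub v.2

theorem exists_H1_of_isTestFunction {ψ : EuclideanSpace ℝ (Fin d) → ℝ} (hψ : IsTestFunction Ω ψ) :
    ∃ w : H1 Ω, ∀ᵐ x ∂(volume.restrict Ω), (H1.incl Ω w).fst x = ψ x := by
  let g : EuclideanSpace ℝ (Fin d) → EuclideanSpace ℝ (Fin d) := fun x =>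
    WithLp.toLp 2 fun i => fderiv ℝ ψ x (EuclideanSpace.single i 1)
  have hg : MemLp g 2 (volume.restrict Ω) := by
    refine Continuous.memLp_of_hasCompactSupport ?_ ?_
    · exact (PiLp.continuous_toLp 2 _).comp
        (continuous_pi fun i => (hψ.fderiv_apply _).1.continuous)
    · refine hψ.2.1.mono' fun x hx => ?_
      by_contra hcon
      apply hx
      have h0 : fderiv ℝ ψ x = 0 := by
        by_contra h
        exact hcon (tsupport_fderiv_subset ℝ (subset_tsupport _ h))
      ext i
      simp [g, h0]
  refine ⟨⟨WithLp.toLp 2 (hψ.memLp.toLp ψ, hg.toLp g), fun i χ hχ => ?_⟩, hψ.memLp.coeFn_toLp⟩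
  have e1 : ∫ x in Ω, (hψ.memLp.toLp ψ) x * fderiv ℝ χ x (EuclideanSpace.single i 1)
      = ∫ x in Ω, ψ x * fderiv ℝ χ x (EuclideanSpace.single i 1) := by
    refine integral_congr_ae ?_
    filter_upwards [hψ.memLp.coeFn_toLp] with x hx
    rw [hx]
  have e2 : ∫ x in Ω, (hg.toLp g) x i * χ x
      = ∫ x in Ω, fderiv ℝ ψ x (EuclideanSpace.single i 1) * χ x := by
    refine integral_congr_ae ?_
    filter_upwards [hg.coeFn_toLp] with x hx
    rw [hx]
  exact (e1.trans (setIntegral_mul_fderiv hψ hχ _)).trans (congrArg Neg.neg e2.symm)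

/-- A bump function in a ball inside Ω equals 1 at the centre, so by continuity it is not almost
everywhere zero. Without this the sets of quotients would be empty. -/
theorem nontrivial_H10 (hΩ : IsOpen Ω) (hne : Ω.Nonempty) : Nontrivial (H10 Ω) := by
  obtain ⟨c, hc⟩ := hne
  obtain ⟨r, hr, hball⟩ := Metric.isOpen_iff.1 hΩ c hc
  let f : ContDiffBump c := ⟨r / 4, r / 2, by linarith, by linarith⟩
  have hf : IsTestFunction Ω f :=
    ⟨f.contDiff, f.hasCompactSupport, by
      rw [f.tsupport_eq]
      exact (Metric.closedBall_subset_ball (by simp only [f]; linarith)).trans hball⟩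
  obtain ⟨w, hw⟩ := exists_H1_of_isTestFunction hf
  have hmem : w ∈ H10Submodule Ω :=
    Submodule.le_topologicalClosure _ (Submodule.subset_span ⟨f, hf, hw⟩)
  refine ⟨⟨⟨w, hmem⟩, 0, fun h0 => ?_⟩⟩
  have hw0 : w = 0 := congrArg Subtype.val h0
  have h1 : ∀ᵐ x ∂(volume.restrict Ω), (H1.incl Ω w).fst x = 0 := by
    rw [hw0]
    exact Lp.coeFn_zero _ _ _
  have h2 : f =ᵐ[volume.restrict Ω] fun _ => (0 : ℝ) := by
    filter_upwards [hw, h1] with x h3 h4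
    rw [← h3, h4]
  have h3 := Measure.eqOn_open_of_ae_eq h2 hΩ f.continuous.continuousOn continuousOn_const hc
  rw [f.one_of_mem_closedBall (Metric.mem_closedBall_self (by simp only [f]; linarith))] at h3
  exact one_ne_zero h3

end Sobolev

/-- Cauchy–Schwarz, attained at v = z; if z = 0, any nonzero v gives the value 0. It serves twice:
for the H⁻¹ norm, with A the gradient, and for the quotients of B_Y, with A the gradient on X. -/
theorem isLUB_inner_div_norm {X E : Type*} [AddCommGroup X] [Module ℝ X] [Nontrivial X]
    [NormedAddCommGroup E] [InnerProductSpace ℝ E] (A : X →ₗ[ℝ] E) (hA : ∀ v, A v = 0 → v = 0)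
    (z : X) : IsLUB {r : ℝ | ∃ v : X, v ≠ 0 ∧ r = inner ℝ (A z) (A v) / ‖A v‖} ‖A z‖ := by
  constructor
  · rintro r ⟨v, hv, rfl⟩
    have hpos : 0 < ‖A v‖ := norm_pos_iff.2 fun h => hv (hA v h)
    rw [div_le_iff₀ hpos]
    exact real_inner_le_norm _ _
  · intro b hb
    by_cases hz : z = 0
    · obtain ⟨v, hv⟩ := exists_ne (0 : X)
      have := hb ⟨v, hv, rfl⟩
      simpa [hz] using this
    · have hpos : 0 < ‖A z‖ := norm_pos_iff.2 fun h => hz (hA z h)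
      have := hb ⟨z, hz, rfl⟩
      rwa [real_inner_self_eq_norm_sq, sq, mul_div_cancel_right₀ _ hpos.ne'] at this

/-! ### The Riesz map of H⁻¹(Ω) for the gradient inner product. -/

section Riesz

variable {d : ℕ} {Ω : Set (EuclideanSpace ℝ (Fin d))}

theorem eq_zero_of_grad_eq_zero (hd : 1 ≤ d) (hΩ : MeasurableSet Ω) (hb : Bornology.IsBounded Ω)
    (v : H10 Ω) (hv : grad Ω v = 0) : v = 0 := by
  obtain ⟨C, -, h⟩ := exists_norm_toL2_sq_le hd hΩ hb
  have h1 := h v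
  have h2 := norm_sq_H10 v
  rw [hv, norm_zero, zero_pow two_ne_zero] at h1 h2
  rw [← norm_eq_zero, ← sq_eq_zero_iff]
  nlinarith [sq_nonneg ‖v‖]

/-- The Riesz isomorphism of `H⁻¹(Ω)` with `H¹₀(Ω)` for the inner product `(∇u, ∇v)_Ω`. -/
theorem exists_riesz (hd : 1 ≤ d) (hΩ : MeasurableSet Ω) (hb : Bornology.IsBounded Ω) :
    ∃ R : HNeg Ω →L[ℝ] H10 Ω, ∀ Φ v, inner ℝ (grad Ω (R Φ)) (grad Ω v) = Φ v := by
  obtain ⟨C, hC, h⟩ := exists_norm_toL2_sq_le hd hΩ hb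
  let B : H10 Ω →L[ℝ] HNeg Ω :=
    ((ContinuousLinearMap.compL ℝ (H10 Ω) (L2Vec Ω) ℝ).flip (grad Ω)).comp
      ((innerSL ℝ).comp (grad Ω))
  have hB : ∀ u v, B u v = inner ℝ (grad Ω u) (grad Ω v) := fun u v => rfl
  -- With C the Poincaré constant, ‖v‖² = ‖v‖²_{L²} + ‖∇v‖² ≤ (C + 1)‖∇v‖².
  have hco : IsCoercive B := by
    refine ⟨(C + 1)⁻¹, by positivity, fun v => ?_⟩
    rw [hB, real_inner_self_eq_norm_sq, mul_assoc, ← sq, inv_mul_le_iff₀ (by positivity),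
      norm_sq_H10]
    linarith [h v]
  have hinj : B.ker = ⊥ := by
    refine LinearMap.ker_eq_bot'.2 fun v hv => eq_zero_of_grad_eq_zero hd hΩ hb v ?_
    have h0 : B v v = 0 := by
      have : B v = 0 := hv
      rw [this]
      rfl
    rwa [hB, inner_self_eq_zero] at h0
  -- Lax–Milgram solves the equation for data in H¹₀(Ω); the Riesz map of the H¹ inner product first
  -- represents Φ there.
  have hsurj : B.range = ⊤ := by
    refine LinearMap.range_eq_top.2 fun Φ => ?_
    refine ⟨hco.continuousLinearEquivOfBilin.symm ((InnerProductSpace.toDual ℝ (H10 Ω)).symm Φ), ?_⟩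
    ext v
    have e := hco.continuousLinearEquivOfBilin_apply
      (hco.continuousLinearEquivOfBilin.symm ((InnerProductSpace.toDual ℝ (H10 Ω)).symm Φ)) v
    rw [ContinuousLinearEquiv.apply_symm_apply, InnerProductSpace.toDual_symm_apply] at e
    exact e.symm
  refine ⟨((ContinuousLinearEquiv.ofBijective B hinj hsurj).symm : HNeg Ω →L[ℝ] H10 Ω),
    fun Φ v => ?_⟩
  rw [← hB]
  have e : B ((ContinuousLinearEquiv.ofBijective B hinj hsurj).symm Φ) = Φ :=
    (ContinuousLinearEquiv.ofBijective B hinj hsurj).apply_symm_apply Φ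
  exact DFunLike.congr_fun e v

theorem normHNeg_eq_norm_grad (hd : 1 ≤ d) (hΩ : IsOpen Ω) (hb : Bornology.IsBounded Ω)
    (hne : Ω.Nonempty) {R : HNeg Ω →L[ℝ] H10 Ω}
    (hR : ∀ Φ v, inner ℝ (grad Ω (R Φ)) (grad Ω v) = Φ v) (Φ : HNeg Ω) :
    normHNeg Ω Φ = ‖grad Ω (R Φ)‖ := by
  have := nontrivial_H10 hΩ hne
  obtain ⟨v, hv⟩ := exists_ne (0 : H10 Ω)
  have h := isLUB_inner_div_norm (grad Ω).toLinearMap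
    (eq_zero_of_grad_eq_zero hd hΩ.measurableSet hb) (R Φ)
  simp only [ContinuousLinearMap.coe_coe, hR] at h
  exact h.csSup_eq ⟨_, v, hv, rfl⟩

end Riesz

/-! ### The space-time identity. -/

section Parabolic

variable {d : ℕ} {Ω : Set (EuclideanSpace ℝ (Fin d))} {T : ℝ}

theorem nontrivial_SpaceX [Nontrivial (H10 Ω)] (hT : 0 < T) : Nontrivial (SpaceX Ω T) := by
  obtain ⟨v, hv⟩ := exists_ne (0 : H10 Ω)
  have : NeZero (volume.restrict (Ioo 0 T)) := ⟨by
    rw [Ne, Measure.restrict_eq_zero, Real.volume_Ioo, ENNReal.ofReal_eq_zero]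
    linarith⟩
  refine ⟨Lp.const 2 (volume.restrict (Ioo 0 T)) v, 0, fun h0 => hv ?_⟩
  have h1 := Lp.coeFn_const (p := 2) (volume.restrict (Ioo 0 T)) v
  rw [h0] at h1
  obtain ⟨t, h2, h3⟩ := (h1.and (Lp.coeFn_zero (H10 Ω) 2 (volume.restrict (Ioo 0 T)))).exists
  rw [h3] at h2
  exact h2.symm

theorem memLp_dt {φ : SpaceX Ω T} (hφ : φ ∈ SpaceY Ω T) :
    MemLp (dt Ω T φ) 2 (volume.restrict (Ioo 0 T)) := by
  have h : MemH1Time (Ioo 0 T) (asHNeg Ω T φ) := hφ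
  rw [dt, weakTimeDeriv, dif_pos h]
  exact h.2.choose_spec.1

theorem isWeakTimeDeriv_dt {φ : SpaceX Ω T} (hφ : φ ∈ SpaceY Ω T) :
    IsWeakTimeDeriv (Ioo 0 T) (fun t => (innerSL ℝ (toL2 Ω (φ t))).comp (toL2 Ω)) (dt Ω T φ) := by
  have h : MemH1Time (Ioo 0 T) (asHNeg Ω T φ) := hφ
  rw [dt, weakTimeDeriv, dif_pos h]
  exact h.2.choose_spec.2

theorem isContinuousRep_valueAt (hT : 0 < T) {φ : SpaceX Ω T} (hφ : φ ∈ SpaceY Ω T) :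
    IsContinuousRep Ω T φ (valueAt Ω T φ) := by
  have h : ∃ u, IsContinuousRep Ω T φ u :=
    (isWeakTimeDeriv_dt hφ).exists_continuousOn (toL2 Ω) hT (Lp.memLp φ) (memLp_dt hφ)
  rw [valueAt, dif_pos h]
  exact h.choose_spec

/-- The gradient as an operator on `L²(0,T; H¹₀(Ω))`. -/
noncomputable def gradX (Ω : Set (EuclideanSpace ℝ (Fin d))) (T : ℝ) :
    SpaceX Ω T →L[ℝ] Lp (L2Vec Ω) 2 (volume.restrict (Ioo 0 T)) :=
  (grad Ω).compLpL 2 (volume.restrict (Ioo 0 T))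

theorem coeFn_gradX (v : SpaceX Ω T) :
    ∀ᵐ t ∂(volume.restrict (Ioo 0 T)), gradX Ω T v t = grad Ω (v t) :=
  (grad Ω).coeFn_compLpL v

theorem norm_gradX_sq (v : SpaceX Ω T) :
    ‖gradX Ω T v‖ ^ 2 = ∫ t in Ioo 0 T, ‖grad Ω (v t)‖ ^ 2 := by
  rw [Lp.norm_sq_eq_integral]
  refine integral_congr_ae ?_
  filter_upwards [coeFn_gradX v] with t ht
  rw [ht]

theorem normX_eq_norm_gradX (v : SpaceX Ω T) : normX Ω T v = ‖gradX Ω T v‖ := by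
  rw [normX, ← norm_gradX_sq, Real.sqrt_sq (norm_nonneg _)]

theorem eq_zero_of_gradX_eq_zero (hd : 1 ≤ d) (hΩ : MeasurableSet Ω)
    (hb : Bornology.IsBounded Ω) (v : SpaceX Ω T) (hv : gradX Ω T v = 0) : v = 0 := by
  have h1 := coeFn_gradX v
  rw [hv] at h1
  refine Lp.ext ?_
  filter_upwards [h1, Lp.coeFn_zero (L2Vec Ω) 2 (volume.restrict (Ioo 0 T)),
    Lp.coeFn_zero (H10 Ω) 2 (volume.restrict (Ioo 0 T))] with t h2 h3 h4
  rw [h4, Pi.zero_apply]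
  rw [h3, Pi.zero_apply] at h2
  exact eq_zero_of_grad_eq_zero hd hΩ hb _ h2.symm

theorem formBY_eq_inner {R : HNeg Ω →L[ℝ] H10 Ω}
    (hR : ∀ Φ v, inner ℝ (grad Ω (R Φ)) (grad Ω v) = Φ v) {φ z : SpaceX Ω T}
    (hz : ∀ᵐ t ∂(volume.restrict (Ioo 0 T)), z t = R (dt Ω T φ t) + φ t) (v : SpaceX Ω T) :
    formBY Ω T φ v = inner ℝ (gradX Ω T z) (gradX Ω T v) := by
  rw [formBY, L2.inner_def]
  refine integral_congr_ae ?_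
  filter_upwards [hz, coeFn_gradX z, coeFn_gradX v] with t h1 h2 h3
  rw [h2, h3, h1, map_add, inner_add_left, hR]

/-- Expanding ‖∇R∂ₜφ + ∇φ‖² pointwise, the Riesz property makes the cross term 2⟨∂ₜφ, φ⟩, and
integration by parts in time evaluates its integral. -/
theorem norm_gradX_sq_eq (hd : 1 ≤ d) (hΩ : IsOpen Ω) (hb : Bornology.IsBounded Ω)
    (hne : Ω.Nonempty) (hT : 0 < T) {R : HNeg Ω →L[ℝ] H10 Ω}
    (hR : ∀ Φ v, inner ℝ (grad Ω (R Φ)) (grad Ω v) = Φ v) {φ z : SpaceX Ω T}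
    (hφ : φ ∈ SpaceY Ω T)
    (hz : ∀ᵐ t ∂(volume.restrict (Ioo 0 T)), z t = R (dt Ω T φ t) + φ t) :
    ‖gradX Ω T z‖ ^ 2
      = (∫ t in Ioo 0 T, (normHNeg Ω (dt Ω T φ t) ^ 2 + ‖grad Ω (φ t)‖ ^ 2))
        + (‖valueAt Ω T φ T‖ ^ 2 - ‖valueAt Ω T φ 0‖ ^ 2) := by
  have hrep := isContinuousRep_valueAt hT hφ
  have hw := memLp_dt hφ
  rw [(isWeakTimeDeriv_dt hφ).norm_sq_sub_norm_sq (toL2 Ω) hT (Lp.memLp φ) hw hrep.1 hrep.2,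
    norm_gradX_sq, ← integral_const_mul]
  simp only [normHNeg_eq_norm_grad hd hΩ hb hne hR]
  have i1 : Integrable (fun t => ‖grad Ω (R (dt Ω T φ t))‖ ^ 2) (volume.restrict (Ioo 0 T)) :=
    (hw.continuousLinearMap_comp ((grad Ω).comp R)).integrable_norm_pow (by norm_num)
  have i2 : Integrable (fun t => ‖grad Ω (φ t)‖ ^ 2) (volume.restrict (Ioo 0 T)) :=
    ((Lp.memLp φ).continuousLinearMap_comp (grad Ω)).integrable_norm_pow (by norm_num)
  rw [← integral_add (i1.fun_add i2) ((hw.integrable_apply (Lp.memLp φ)).const_mul 2)]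
  refine integral_congr_ae ?_
  filter_upwards [hz] with t ht
  rw [ht, map_add, norm_add_sq_real, hR]
  ring

end Parabolic

theorem mainTheorem5 (d : ℕ) (hd : 1 ≤ d) (Ω : Set (EuclideanSpace ℝ (Fin d)))
    (hΩ_open : IsOpen Ω) (hΩ_bdd : Bornology.IsBounded Ω) (hΩ_ne : Ω.Nonempty)
    (T : ℝ) (hT : 0 < T) (φ : SpaceX Ω T) (hφ : φ ∈ SpaceY Ω T) :
    IsContinuousRep Ω T φ (valueAt Ω T φ) ∧
    (quotientsBY Ω T φ).Nonempty ∧ BddAbove (quotientsBY Ω T φ) ∧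
    normY Ω T φ ^ 2 = sSup (quotientsBY Ω T φ) ^ 2 + ‖valueAt Ω T φ 0‖ ^ 2 := by
  have := nontrivial_H10 hΩ_open hΩ_ne
  have := nontrivial_SpaceX (Ω := Ω) hT
  obtain ⟨R, hR⟩ := exists_riesz hd hΩ_open.measurableSet hΩ_bdd
  -- This is the maximiser z; boundedness of R puts it in X.
  have hzm : MemLp (fun t => R (dt Ω T φ t) + φ t) 2 (volume.restrict (Ioo 0 T)) :=
    ((memLp_dt hφ).continuousLinearMap_comp R).add (Lp.memLp φ)
  have hz := hzm.coeFn_toLp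
  have hset : quotientsBY Ω T φ = {r : ℝ | ∃ v : SpaceX Ω T, v ≠ 0 ∧
      r = inner ℝ (gradX Ω T (hzm.toLp _)) (gradX Ω T v) / ‖gradX Ω T v‖} := by
    simp only [quotientsBY, normX_eq_norm_gradX, formBY_eq_inner hR hz]
  have hlub : IsLUB (quotientsBY Ω T φ) ‖gradX Ω T (hzm.toLp _)‖ := by
    rw [hset]
    exact isLUB_inner_div_norm (gradX Ω T).toLinearMap
      (eq_zero_of_gradX_eq_zero hd hΩ_open.measurableSet hΩ_bdd) _
  have hne : (quotientsBY Ω T φ).Nonempty := by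
    obtain ⟨v, hv⟩ := exists_ne (0 : SpaceX Ω T)
    exact ⟨_, v, hv, rfl⟩
  refine ⟨isContinuousRep_valueAt hT hφ, hne, hlub.bddAbove, ?_⟩
  rw [hlub.csSup_eq hne, norm_gradX_sq_eq hd hΩ_open hΩ_bdd hΩ_ne hT hR hφ hz, normY,
    Real.sq_sqrt]
  · ring
  · exact add_nonneg (integral_nonneg fun t => by positivity) (by positivity)
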